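/- Let $G$ be a finite group and let $\pi$ be a set of primes with complement $\pi'$ in the set of all primes. Assume that $G$ is $\pi$-separable, i.e. $G$ has a series $1=N_0\le N_1\le\dots\le N_l=G$ of normal subgroups such that the order of each factor $N_{i}/N_{i-1}$ is either a $\pi$-number or a $\pi'$-number. Let $H^2G=Z^2G/B^2G$ be the Schur multiplier of $G$ (2-cocycles modulo 2-coboundaries with values in $\mathbb C^\times$, trivial action). For a cocycle $\alpha\in Z^2G$, an $\alpha$-representation on a finite-dimensional complex vector space $V$ is a map $\varphi:G\to\mathrm{GL}(V)$ with $\varphi(x)\varphi(y)=\alpha(x,y)\varphi(xy)$, that is, a module over the twisted group algebra $\mathbb C^{\alpha}G$; if $c=[\alpha]$, then $V$ is called a $c$-module. It is irreducible if $V\neq 0$ and the only invariant subspaces are $0$ and $V$, and it is an ordinary module if some rescaling $g\mapsto\zeta(g)\varphi(g)$ with $\zeta:G\to\mathbb C^\times$ is a linear representation. For $J\le G$, a module $U$ over $\mathbb C^{\alpha|_J}J$ induces the $c$-module $U^{G}=\mathbb C^{\alpha}G\otimes_{\mathbb C^{\alpha|_J}J}U$. Let $V$ be an irreducible $c$-module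 of $G$, with cocycle $\alpha$, $[\alpha]=c$. Then $c=c_\pi c_{\pi'}$ for (necessarily unique) coclasses $c_\pi,c_{\pi'}\in H^2G$ whose orders are a $\pi$-number and a $\pi'$-number respectively, and there are a subgroup $J\le G$, cocycles $\alpha_\pi,\alpha_{\pi'}\in Z^2J$ with $[\alpha_\pi]=c_\pi|_J$, $[\alpha_{\pi'}]=c_{\pi'}|_J$ and $\alpha_\pi\alpha_{\pi'}=\alpha|_J$, an irreducible $\alpha_\pi$-representation $V_\pi$ of $J$ and an irreducible $\alpha_{\pi'}$-representation $V_{\pi'}$ of $J$, such that $$V\cong (V_\pi\otimes V_{\pi'})^{G}$$ as modules over $\mathbb C^{\alpha}G$. Moreover, $J$ has Hall $\pi$-subgroups and Hall $\pi'$-subgroups, and for every Hall $\pi$-subgroup $H$ and every Hall $\pi'$-subgroup $H'$ of $J$ the restrictions $V_\pi|_{H}$ and $V_{\pi'}|_{H'}$ are irreducible, whereas $V_{\pi'}|_{H}$ and $V_\pi|_{H'}$ are ordinary modules. -/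

import Mathlib

open scoped TensorProduct

universe u v

noncomputable section

/-! ### Sets of primes, Hall subgroups, separable groups -/

/-- `n` is a `π`-number: `n` is a positive integer all of whose prime divisors lie in `π`.
The complementary set of primes `π'` is `πᶜ`. -/
def IsPiNumber (π : Set Nat.Primes) (n : ℕ) : Prop :=
  n ≠ 0 ∧ ∀ p : Nat.Primes, (p : ℕ) ∣ n → p ∈ π

/-- A Hall `π`-subgroup of a finite group: its order is a `π`-number and its index is a
`π'`-number. -/
def IsHallSubgroup {G : Type*} [Group G] (π : Set Nat.Primes) (H : Subgroup G) : Prop :=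
  IsPiNumber π (Nat.card H) ∧ IsPiNumber πᶜ H.index

/-- `G` is `π`-separable: there is a series `1 = N 0 ≤ N 1 ≤ ⋯ ≤ N l = G` of normal subgroups
of `G` such that the order of each factor `N (i + 1) / N i` is a `π`-number or a `π'`-number. -/
def IsPiSeparable (π : Set Nat.Primes) (G : Type*) [Group G] : Prop :=
  ∃ (l : ℕ) (N : ℕ → Subgroup G),
    N 0 = ⊥ ∧ N l = ⊤ ∧
    ∀ i < l, N i ≤ N (i + 1) ∧ (N i).Normal ∧ (N (i + 1)).Normal ∧
      (IsPiNumber π ((N i).relIndex (N (i + 1))) ∨ IsPiNumber πᶜ ((N i).relIndex (N (i + 1))))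

/-! ### Cocycles, coboundaries and the Schur multiplier -/

/-- The group `Z²G` of `2`-cocycles of `G` with values in `ℂˣ` (trivial action), with pointwise
multiplication. -/
def Z2 (G : Type*) [Group G] : Subgroup (G → G → ℂˣ) where
  carrier := {α | ∀ x y z : G, α x y * α (x * y) z = α y z * α x (y * z)}
  one_mem' := by intro x y z; simp
  mul_mem' := by
    intro α β hα hβ x y z
    have h1 := hα x y z
    have h2 := hβ x y z
    simp only [Pi.mul_apply]
    rw [mul_mul_mul_comm, h1, h2, mul_mul_mul_comm]
  inv_mem' := by
    intro α hα x y z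
    have h1 := hα x y z
    simp only [Pi.inv_apply]
    rw [← mul_inv, ← mul_inv, h1]

/-- The coboundary homomorphism `ζ ↦ δζ`, where `δζ (x, y) = ζ x * ζ y / ζ (x * y)`. -/
def Z2.coboundary (G : Type*) [Group G] : (G → ℂˣ) →* Z2 G where
  toFun ζ := ⟨fun x y => ζ x * ζ y / ζ (x * y), by
    intro x y z
    simp only [div_eq_mul_inv, mul_assoc]
    rw [mul_comm (ζ (x * y))⁻¹]
    simp only [mul_left_comm, mul_comm]
    simp⟩
  map_one' := by ext; simp
  map_mul' ζ η := by
    apply Subtype.ext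
    funext x y
    simp only [Pi.mul_apply, Subgroup.coe_mul]
    rw [mul_mul_mul_comm, mul_div_mul_comm]

/-- The group `B²G` of coboundaries. -/
def B2 (G : Type*) [Group G] : Subgroup (Z2 G) := (Z2.coboundary G).range

/-- The Schur multiplier `H²G = Z²G / B²G`; its elements are the coclasses of `G`. -/
abbrev H2 (G : Type*) [Group G] : Type _ := Z2 G ⧸ B2 G

/-- The coclass of a cocycle. -/
def Z2.coclass {G : Type*} [Group G] (α : Z2 G) : H2 G := QuotientGroup.mk α

/-- Restriction of cocycles to a subgroup. -/
def Z2.res {G : Type*} [Group G] (J : Subgroup G) : Z2 G →* Z2 J where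
  toFun α := ⟨fun x y => α.1 x y, fun x y z => α.2 x y z⟩
  map_one' := rfl
  map_mul' _ _ := rfl

/-- Restriction of coclasses to a subgroup. -/
def H2.res {G : Type*} [Group G] (J : Subgroup G) : H2 G →* H2 J :=
  QuotientGroup.map (B2 G) (B2 J) (Z2.res J) (by
    rintro _ ⟨ζ, rfl⟩
    exact ⟨fun x => ζ x, rfl⟩)

/-! ### Projective representations with a given cocycle -/

/-- A projective representation of `G` on `V` with a chosen section `φ : G → GL(V)` whose cocycle
is `α`, that is, `φ x * φ y = α (x, y) φ (x y)`. Equivalently, a module structure on `V` over the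
twisted group algebra of `G` associated with `α`. A `c`-module is a finite-dimensional `V` with
such a `φ` where `α` is a cocycle in the coclass `c`. -/
structure TwistedRep {G : Type*} [Group G] (α : Z2 G) (V : Type*) [AddCommGroup V]
    [Module ℂ V] where
  toFun : G → LinearMap.GeneralLinearGroup ℂ V
  map_mul : ∀ x y : G, toFun x * toFun y = α.1 x y • toFun (x * y)

namespace TwistedRep

section Basic

variable {G : Type*} [Group G] {α β : Z2 G} {V W : Type*} [AddCommGroup V] [Module ℂ V]
  [AddCommGroup W] [Module ℂ W]

/-- The linear endomorphism by which `g` acts. -/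
def act (ρ : TwistedRep α V) (g : G) : V →ₗ[ℂ] V := (ρ.toFun g : V →ₗ[ℂ] V)

lemma act_act (ρ : TwistedRep α V) (x y : G) (v : V) :
    ρ.act x (ρ.act y v) = (α.1 x y : ℂ) • ρ.act (x * y) v := by
  exact congrArg (fun u : LinearMap.GeneralLinearGroup ℂ V => (u : V →ₗ[ℂ] V) v)
    (ρ.map_mul x y)

lemma act_one (ρ : TwistedRep α V) (v : V) : ρ.act 1 v = (α.1 1 1 : ℂ) • v := by
  have h1 := ρ.act_act 1 1
  have hs : ∀ w, ∃ u, ρ.act 1 u = w := fun w =>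
    ⟨((ρ.toFun 1)⁻¹ : LinearMap.GeneralLinearGroup ℂ V).val w,
      congrArg (fun u : LinearMap.GeneralLinearGroup ℂ V => (u : V →ₗ[ℂ] V) w)
        (mul_inv_cancel (ρ.toFun 1))⟩
  obtain ⟨u, rfl⟩ := hs v
  rw [h1, mul_one]

/-- Endomorphisms `T x` with `T 1 = α (1, 1)` and `T x * T y = α (x, y) T (x y)` are invertible,
and so they define a section with values in `GL(V)`. -/
def ofEnd (α : Z2 G) (T : G → V →ₗ[ℂ] V) (h1 : ∀ v, T 1 v = (α.1 1 1 : ℂ) • v)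
    (hmul : ∀ x y v, T x (T y v) = (α.1 x y : ℂ) • T (x * y) v) : TwistedRep α V where
  toFun x :=
    { val := T x
      inv := ((α.1 x x⁻¹ * α.1 1 1)⁻¹ : ℂˣ) • T x⁻¹
      val_inv := by
        apply LinearMap.ext
        intro v
        simp only [Module.End.mul_apply, Units.smul_def, LinearMap.smul_apply, map_smul, hmul,
          mul_inv_cancel, h1, smul_smul, Module.End.one_apply]
        rw [← Units.val_mul, ← Units.val_mul, inv_mul_cancel, Units.val_one, one_smul]
      inv_val := by
        have hc : α.1 x⁻¹ x = α.1 x x⁻¹ := by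
          have e1 := α.2 x x⁻¹ x
          have e2 := α.2 1 1 x
          have e3 := α.2 x 1 1
          simp only [mul_inv_cancel, inv_mul_cancel, one_mul, mul_one] at e1 e2 e3
          have e4 : α.1 1 1 = α.1 1 x := mul_right_cancel e2
          have e5 : α.1 x 1 = α.1 1 1 := mul_right_cancel e3
          rw [← e4, e5] at e1
          exact (mul_right_cancel e1).symm
        apply LinearMap.ext
        intro v
        simp only [Module.End.mul_apply, Units.smul_def, LinearMap.smul_apply, hmul,
          inv_mul_cancel, h1, smul_smul, Module.End.one_apply]
        rw [hc, ← Units.val_mul, ← Units.val_mul, inv_mul_cancel, Units.val_one, one_smul] }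
  map_mul x y := by
    apply Units.ext
    apply LinearMap.ext
    intro v
    simpa [Units.smul_def] using hmul x y v

/-- The same representation, the cocycle being replaced by an equal one. -/
def cast (h : α = β) (ρ : TwistedRep α V) : TwistedRep β V where
  toFun := ρ.toFun
  map_mul := h ▸ ρ.map_mul

/-- Irreducibility: `V` is non-zero and its only invariant subspaces are `0` and `V`. -/
def IsIrreducible (ρ : TwistedRep α V) : Prop :=
  Nontrivial V ∧
    ∀ U : Submodule ℂ V, (∀ g : G, ∀ w ∈ U, ρ.act g w ∈ U) → U = ⊥ ∨ U = ⊤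

/-- Isomorphism of modules over the twisted group algebra associated with `α`. -/
def IsIsomorphic (ρ : TwistedRep α V) (σ : TwistedRep α W) : Prop :=
  ∃ e : V ≃ₗ[ℂ] W, ∀ (g : G) (v : V), e (ρ.act g v) = σ.act g (e v)

/-- The module is ordinary: some section of the underlying projective representation, i.e. some
rescaling `g ↦ ζ g • ρ g`, is an ordinary linear representation. -/
def IsOrdinary (ρ : TwistedRep α V) : Prop :=
  ∃ (σ : Representation ℂ G V) (ζ : G → ℂˣ), ∀ g : G, σ g = (ζ g : ℂ) • ρ.act g

/-- Restriction to a subgroup. -/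
def res (J : Subgroup G) (ρ : TwistedRep α V) : TwistedRep (Z2.res J α) V where
  toFun x := ρ.toFun x
  map_mul x y := ρ.map_mul x y

/-- The tensor product, with the diagonal action; its cocycle is the product of the cocycles. -/
def tensor (ρ : TwistedRep α V) (σ : TwistedRep β W) : TwistedRep (α * β) (V ⊗[ℂ] W) :=
  ofEnd (α * β) (fun g => TensorProduct.map (ρ.act g) (σ.act g))
    (by
      intro t
      induction t with
      | zero => simp
      | add a b ha hb => rw [map_add, ha, hb, smul_add]
      | tmul v w =>
        simp only [TensorProduct.map_tmul, act_one, TensorProduct.smul_tmul_smul]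
        rfl)
    (by
      intro x y t
      induction t with
      | zero => simp
      | add a b ha hb => simp only [map_add, ha, hb, smul_add]
      | tmul v w =>
        simp only [TensorProduct.map_tmul, act_act, TensorProduct.smul_tmul_smul]
        rfl)

end Basic

/-! ### Induction -/

section Induction

variable {G : Type*} [Group G] {α : Z2 G} {J : Subgroup G} {U : Type*} [AddCommGroup U]
  [Module ℂ U]

/-- `G →₀ U` is the tensor product over `ℂ` of the twisted group algebra `ℂ^α G` with `U`, where
`single g u` stands for `g ⊗ u`. This is the subspace spanned by the elements
`g ⊗ h u - g h ⊗ u` with `h ∈ J`, where the product of the basis elements `g` and `h` of the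
twisted group algebra is `α (g, h)` times the basis element `g * h`. -/
def indRel (ρ : TwistedRep (Z2.res J α) U) : Submodule ℂ (G →₀ U) :=
  Submodule.span ℂ {t | ∃ (g : G) (h : J) (w : U),
    t = Finsupp.single g (ρ.act h w) - (α.1 g h : ℂ) • Finsupp.single (g * (h : G)) w}

/-- The space of the induced module, i.e. the tensor product of `ℂ^α G` and `U` over
`ℂ^α J`. -/
abbrev IndSpace (ρ : TwistedRep (Z2.res J α) U) : Type _ := (G →₀ U) ⧸ indRel ρ

/-- Left multiplication by the basis element `x` on `ℂ^α G ⊗ U`: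
it sends `g ⊗ u` to `α (x, g) (x g) ⊗ u`. -/
def indPre (α : Z2 G) (U : Type*) [AddCommGroup U] [Module ℂ U] (x : G) :
    (G →₀ U) →ₗ[ℂ] (G →₀ U) :=
  Finsupp.lsum ℂ fun g => (α.1 x g : ℂ) • Finsupp.lsingle (x * g)

lemma indPre_single (x g : G) (w : U) :
    indPre α U x (Finsupp.single g w) = (α.1 x g : ℂ) • Finsupp.single (x * g) w := by
  simp [indPre]

lemma indRel_le_comap (ρ : TwistedRep (Z2.res J α) U) (x : G) :
    indRel ρ ≤ (indRel ρ).comap (indPre α U x) := by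
  refine Submodule.span_le.2 ?_
  rintro _ ⟨g, h, w, rfl⟩
  have key : indPre α U x (Finsupp.single g (ρ.act h w) -
        (α.1 g h : ℂ) • Finsupp.single (g * (h : G)) w) =
      (α.1 x g : ℂ) • (Finsupp.single (x * g) (ρ.act h w) -
        (α.1 (x * g) h : ℂ) • Finsupp.single (x * g * (h : G)) w) := by
    have hc := congrArg (Units.val) (α.2 x g h)
    simp only [Units.val_mul] at hc
    rw [map_sub, map_smul, indPre_single, indPre_single, smul_sub, smul_smul, smul_smul, hc,
      mul_assoc x g]
  show indPre α U x _ ∈ indRel ρ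
  rw [key]
  exact Submodule.smul_mem _ _ (Submodule.subset_span ⟨x * g, h, w, rfl⟩)

/-- The module induced from `J` to `G`, i.e. `ℂ^α G ⊗ U` over `ℂ^α J`, where `G` acts by left
multiplication. -/
def ind (ρ : TwistedRep (Z2.res J α) U) : TwistedRep α (IndSpace ρ) :=
  ofEnd α (fun x => (indRel ρ).mapQ (indRel ρ) (indPre α U x) (indRel_le_comap ρ x))
    (by
      intro t
      induction t using Submodule.Quotient.induction_on with
      | H t =>
        rw [Submodule.mapQ_apply, ← Submodule.Quotient.mk_smul]
        congr 1
        induction t using Finsupp.induction_linear with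
        | zero => simp
        | add a b ha hb => rw [map_add, ha, hb, smul_add]
        | single g w =>
          have e2 := α.2 1 1 g
          simp only [one_mul] at e2
          have e4 : α.1 1 1 = α.1 1 g := mul_right_cancel e2
          rw [indPre_single, e4, one_mul])
    (by
      intro x y t
      induction t using Submodule.Quotient.induction_on with
      | H t =>
        simp only [Submodule.mapQ_apply]
        rw [← Submodule.Quotient.mk_smul]
        congr 1
        induction t using Finsupp.induction_linear with
        | zero => simp
        | add a b ha hb => simp only [map_add, ha, hb, smul_add]
        | single g w =>
          have hc := congrArg (Units.val) (α.2 x y g)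
          simp only [Units.val_mul] at hc
          rw [indPre_single, map_smul, indPre_single, indPre_single, smul_smul, smul_smul, hc,
            mul_assoc x y])

end Induction

end TwistedRep

end

/-! Among the subgroups `J` carrying a nonzero `J`-stable `U ≤ V` with dim V = |G:J| dim U, take a
minimal one (`exists_primitive_subrep`). Then `U` is irreducible and primitive for `J`, and
Frobenius reciprocity with a dimension count gives V ≅ U^G (`isIsomorphic_ind`). It remains to
factor a primitive projective representation φ of a π-separable group, which is done up to scalars;
cocycles are restored only at the end.

Let N ≤ K be consecutive terms of the series, with N acting by scalars. The algebra E spanned by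
φ(K) is normalized by every φ(g). It is semisimple, and by primitivity it has only trivial central
idempotents, so E ≅ End Θ (`exists_algEquiv_matrix_of_isPrimitive`). By Skolem–Noether V ≅ Θ ⊗ W
with φ = T ⊗ S up to scalars, where T(K) spans End Θ and S is scalar on K
(`exists_tensor_of_isPrimitive`). Since S is again simple and primitive, the argument repeats one
step higher in the series. The degree of Θ divides |K:N| (`finrank_dvd_index`), hence is a π-number
or a π'-number, and Θ is put into the π-part or the π'-part accordingly.

In the case of a π-number, K = (H ∩ K)N for a Hall π-subgroup H, so T is already absolutely
irreducible on H ∩ K, where the previously collected π-part is scalar. Hence the enlarged π-part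
stays absolutely irreducible on H (`span_tensor_eq_top`, `HasFactorization.tensor`).

Finally, determinants show that the coclass of a projective representation is killed by its degree
(`coclass_pow_finrank`). The two factors therefore have coclasses of π- and π'-order, and uniqueness
of such a decomposition identifies them with the restrictions of the two parts of c. A coclass of
π'-order becomes trivial on a π-subgroup (`H2.pow_card_eq_one`), which makes the respective
restrictions ordinary. -/

noncomputable section

/-! ### π-numbers, and the π-part and π'-part of a torsion element. -/

section PiNumbers

variable {π : Set Nat.Primes}

lemma IsPiNumber.of_dvd {m n : ℕ} (hn : IsPiNumber π n) (h : m ∣ n) : IsPiNumber π m :=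
  ⟨fun h0 => hn.1 (by rw [h0] at h; exact zero_dvd_iff.1 h), fun p hp => hn.2 p (hp.trans h)⟩

lemma isPiNumber_one (π : Set Nat.Primes) : IsPiNumber π 1 :=
  ⟨one_ne_zero, fun p hp => absurd (Nat.dvd_one.1 hp) p.2.one_lt.ne'⟩

lemma IsPiNumber.mul {m n : ℕ} (hm : IsPiNumber π m) (hn : IsPiNumber π n) :
    IsPiNumber π (m * n) :=
  ⟨mul_ne_zero hm.1 hn.1, fun p hp => ((Nat.Prime.dvd_mul p.2).1 hp).elim (hm.2 p) (hn.2 p)⟩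

lemma IsPiNumber.coprime {m n : ℕ} (hm : IsPiNumber π m) (hn : IsPiNumber πᶜ n) :
    Nat.Coprime m n := by
  by_contra h
  obtain ⟨p, hp, h1, h2⟩ := Nat.Prime.not_coprime_iff_dvd.1 h
  exact hn.2 ⟨p, hp⟩ h2 (hm.2 ⟨p, hp⟩ h1)

lemma exists_eq_mul_isPiNumber (π : Set Nat.Primes) {n : ℕ} (hn : n ≠ 0) :
    ∃ a b, n = a * b ∧ IsPiNumber π a ∧ IsPiNumber πᶜ b := by
  induction n using induction_on_primes with
  | zero => exact absurd rfl hn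
  | one => exact ⟨1, 1, rfl, isPiNumber_one _, isPiNumber_one _⟩
  | prime_mul p n hp ih =>
    obtain ⟨a, b, hab, ha, hb⟩ := ih (right_ne_zero_of_mul hn)
    have key : ∀ σ : Set Nat.Primes, (⟨p, hp⟩ : Nat.Primes) ∈ σ → IsPiNumber σ p := fun σ hσ =>
      ⟨hp.ne_zero, fun q hq => by
        rwa [show q = ⟨p, hp⟩ from Subtype.ext ((Nat.prime_dvd_prime_iff_eq q.2 hp).1 hq)]⟩
    by_cases h : (⟨p, hp⟩ : Nat.Primes) ∈ π
    · exact ⟨p * a, b, by rw [hab, mul_assoc], (key π h).mul ha, hb⟩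
    · exact ⟨a, p * b, by rw [hab, mul_left_comm], ha, (key πᶜ h).mul hb⟩

lemma isPiNumber_orderOf {M : Type*} [Monoid M] {c : M} {n : ℕ} (hn : IsPiNumber π n)
    (hc : c ^ n = 1) : IsPiNumber π (orderOf c) :=
  hn.of_dvd (orderOf_dvd_of_pow_eq_one hc)

/-- Write n = kl with k a π-number and l a π'-number; a Bézout relation between k and l splits the
exponent of `c`. -/
lemma exists_eq_mul_orderOf_isPiNumber {M : Type*} [CommGroup M] (π : Set Nat.Primes) (c : M)
    {n : ℕ} (hn : n ≠ 0) (hc : c ^ n = 1) :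
    ∃ a b : M, c = a * b ∧ IsPiNumber π (orderOf a) ∧ IsPiNumber πᶜ (orderOf b) := by
  obtain ⟨k, l, rfl, hk, hl⟩ := exists_eq_mul_isPiNumber π hn
  have hb := Nat.gcd_eq_gcd_ab k l
  rw [(hk.coprime hl).gcd_eq_one] at hb
  have hc' : c ^ ((k : ℤ) * l) = 1 := by exact_mod_cast hc
  refine ⟨c ^ (l * k.gcdB l : ℤ), c ^ (k * k.gcdA l : ℤ), ?_, isPiNumber_orderOf hk ?_,
    isPiNumber_orderOf hl ?_⟩
  · rw [← zpow_add, add_comm, ← hb]; simp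
  · rw [← zpow_natCast, ← zpow_mul,
      show (l * k.gcdB l : ℤ) * k = (k * l) * k.gcdB l by ring, zpow_mul, hc', one_zpow]
  · rw [← zpow_natCast, ← zpow_mul,
      show (k * k.gcdA l : ℤ) * l = (k * l) * k.gcdA l by ring, zpow_mul, hc', one_zpow]

/-- The element a/x = y/b is killed by the coprime numbers km and ln. -/
lemma eq_and_eq_of_mul_eq_mul_of_isPiNumber {M : Type*} [CommGroup M] {a b x y : M}
    (h : a * b = x * y) {k l m n : ℕ} (hk : IsPiNumber π k) (hl : IsPiNumber πᶜ l)
    (hm : IsPiNumber π m) (hn : IsPiNumber πᶜ n)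
    (ha : a ^ k = 1) (hb : b ^ l = 1) (hx : x ^ m = 1) (hy : y ^ n = 1) :
    a = x ∧ b = y := by
  have e : a / x = y / b := by rw [div_eq_div_iff_mul_eq_mul, h, mul_comm]
  have h1 : (a / x) ^ (k * m) = 1 := by
    rw [div_pow, pow_mul, ha, mul_comm, pow_mul, hx]; simp
  have h2 : (a / x) ^ (l * n) = 1 := by
    rw [e, div_pow, mul_comm, pow_mul, hy, mul_comm, pow_mul, hb]; simp
  have h3 := pow_gcd_eq_one.2 ⟨h1, h2⟩
  rw [((hk.mul hm).coprime (hl.mul hn)).gcd_eq_one, pow_one] at h3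
  exact ⟨div_eq_one.1 h3, (div_eq_one.1 (e ▸ h3)).symm⟩

end PiNumbers

/-! ### Hall subgroups of π-separable groups. -/

section Hall

variable {G : Type*} [Group G] {π : Set Nat.Primes}

lemma IsPiSeparable.compl (hG : IsPiSeparable π G) : IsPiSeparable πᶜ G := by
  obtain ⟨l, N, h0, h1, h⟩ := hG
  refine ⟨l, N, h0, h1, fun i hi => ⟨(h i hi).1, (h i hi).2.1, (h i hi).2.2.1, ?_⟩⟩
  rw [compl_compl]
  exact (h i hi).2.2.2.symm

/-- (K ∩ J)/(N ∩ J) embeds in K/N. This makes π-separability pass to subgroups. -/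
lemma relIndex_subgroupOf_dvd (N K J : Subgroup G) [N.Normal] :
    (N.subgroupOf J).relIndex (K.subgroupOf J) ∣ N.relIndex K := by
  have h1 : (N.subgroupOf J).relIndex (K.subgroupOf J) = N.relIndex (K ⊓ J) := by
    rw [Subgroup.subgroupOf, Subgroup.relIndex_comap, Subgroup.subgroupOf_map_subtype]
  have h2 : (N.subgroupOf K).relIndex (J.subgroupOf K) = N.relIndex (J ⊓ K) := by
    rw [Subgroup.subgroupOf, Subgroup.relIndex_comap, Subgroup.subgroupOf_map_subtype]
  rw [h1, inf_comm, ← h2]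
  exact Subgroup.relIndex_dvd_index_of_normal _ _

lemma IsPiSeparable.subgroup (hG : IsPiSeparable π G) (J : Subgroup G) : IsPiSeparable π J := by
  obtain ⟨l, N, h0, h1, h⟩ := hG
  refine ⟨l, fun i => (N i).subgroupOf J, by simp [h0], by simp [h1], fun i hi => ?_⟩
  obtain ⟨h2, h3, h4, h5⟩ := h i hi
  exact ⟨Subgroup.comap_mono h2, inferInstance, inferInstance,
    h5.imp (fun t => t.of_dvd (relIndex_subgroupOf_dvd _ _ _))
      (fun t => t.of_dvd (relIndex_subgroupOf_dvd _ _ _))⟩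

/-- Schur–Zassenhaus for M/N in G/N; `L` is the preimage of a complement. -/
lemma exists_index_eq_relIndex [Finite G] {N M : Subgroup G} [N.Normal] [M.Normal] (hNM : N ≤ M)
    (hc : Nat.Coprime (N.relIndex M) M.index) :
    ∃ L : Subgroup G, N ≤ L ∧ L.index = N.relIndex M ∧ N.relIndex L = M.index := by
  have hs := QuotientGroup.mk'_surjective N
  have hcard : Nat.card (M.map (QuotientGroup.mk' N)) = N.relIndex M := by
    rw [← Subgroup.relIndex_ker, QuotientGroup.ker_mk']
  have hind : (M.map (QuotientGroup.mk' N)).index = M.index :=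
    Subgroup.index_map_eq _ hs (by rwa [QuotientGroup.ker_mk'])
  have : (M.map (QuotientGroup.mk' N)).Normal := Subgroup.Normal.map inferInstance _ hs
  obtain ⟨C, hC⟩ := Subgroup.exists_right_complement'_of_coprime
    (N := M.map (QuotientGroup.mk' N)) (by rw [hcard, hind]; exact hc)
  refine ⟨C.comap (QuotientGroup.mk' N), ?_, ?_, ?_⟩
  · intro x hx
    rw [Subgroup.mem_comap, show QuotientGroup.mk' N x = 1 from
      (QuotientGroup.eq_one_iff x).2 hx]
    exact one_mem _
  · rw [Subgroup.index_comap_of_surjective _ hs, ← hcard, hC.index_eq_card]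
  · have h := Subgroup.relIndex_ker (C.comap (QuotientGroup.mk' N)) (QuotientGroup.mk' N)
    rw [QuotientGroup.ker_mk'] at h
    rw [h, Subgroup.map_comap_eq_self_of_surjective hs, ← hind,
      hC.symm.index_eq_card]

lemma exists_relIndex_eq_relIndex [Finite G] {N M H : Subgroup G} [N.Normal] [M.Normal]
    (hNM : N ≤ M) (hMH : M ≤ H) (hc : Nat.Coprime (N.relIndex M) (M.relIndex H)) :
    ∃ L : Subgroup G, N ≤ L ∧ L ≤ H ∧ L.relIndex H = N.relIndex M ∧
      N.relIndex L = M.relIndex H := by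
  have h1 : (N.subgroupOf H).relIndex (M.subgroupOf H) = N.relIndex M :=
    Subgroup.relIndex_subgroupOf hMH
  obtain ⟨L, hL1, hL2, hL3⟩ := exists_index_eq_relIndex (N := N.subgroupOf H)
    (M := M.subgroupOf H) (Subgroup.comap_mono hNM) (by rw [h1]; exact hc)
  have h2 : (L.map H.subtype).subgroupOf H = L :=
    Subgroup.comap_map_eq_self_of_injective H.subtype_injective L
  have h3 : L.map H.subtype ≤ H := Subgroup.map_subtype_le L
  refine ⟨L.map H.subtype, ?_, h3, ?_, ?_⟩
  · intro x hx
    exact ⟨⟨x, hMH (hNM hx)⟩, hL1 hx, rfl⟩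
  · rw [Subgroup.relIndex, h2, hL2, h1]
  · rw [← Subgroup.relIndex_subgroupOf h3, h2, hL3]
    rfl

/-- Descend the series, keeping `H` above the current term N with |H:N| a π-number and |G:H| a
π'-number. A π-factor leaves `H` unchanged; a π'-factor is split off by passing to a complement
modulo the next lower term. -/
theorem IsPiSeparable.exists_isHallSubgroup [Finite G] (hG : IsPiSeparable π G) :
    ∃ H : Subgroup G, IsHallSubgroup π H := by
  obtain ⟨l, N, h0, h1, h⟩ := hG
  have key : ∀ k ≤ l, ∃ H : Subgroup G, N (l - k) ≤ H ∧ IsPiNumber π ((N (l - k)).relIndex H) ∧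
      IsPiNumber πᶜ H.index := by
    intro k
    induction k with
    | zero =>
      intro _
      exact ⟨⊤, le_top, by simpa [h1] using isPiNumber_one π, by simpa using isPiNumber_one πᶜ⟩
    | succ k ih =>
      intro hk
      obtain ⟨H, hH1, hH2, hH3⟩ := ih (by omega)
      obtain ⟨hN1, hN2, hN3, hN4⟩ := h (l - (k + 1)) (by omega)
      rw [show l - (k + 1) + 1 = l - k by omega] at hN1 hN3 hN4
      rcases hN4 with hN4 | hN4
      · refine ⟨H, hN1.trans hH1, ?_, hH3⟩
        rw [← Subgroup.relIndex_mul_relIndex _ _ _ hN1 hH1]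
        exact hN4.mul hH2
      · obtain ⟨L, hL1, hL2, hL3, hL4⟩ := exists_relIndex_eq_relIndex hN1 hH1
          (hH2.coprime hN4).symm
        refine ⟨L, hL1, by rwa [hL4], ?_⟩
        rw [← Subgroup.relIndex_mul_index hL2, hL3]
        exact hN4.mul hH3
  obtain ⟨H, -, hH2, hH3⟩ := key l le_rfl
  rw [Nat.sub_self, h0, Subgroup.relIndex_bot_left] at hH2
  exact ⟨H, hH2, hH3⟩

/-- |K : H ∩ K| = |HK : H|, because `K` is normal. -/
lemma relIndex_dvd_index_of_normal_right [Finite G] (H K : Subgroup G) [K.Normal] :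
    H.relIndex K ∣ H.index := by
  have h1 := Subgroup.relIndex_mul_relIndex (H ⊓ K) H (H ⊔ K) inf_le_left le_sup_left
  have h2 := Subgroup.relIndex_mul_relIndex (H ⊓ K) K (H ⊔ K) inf_le_right le_sup_right
  rw [Subgroup.relIndex_sup_right, Subgroup.inf_relIndex_right, ← h1,
    Subgroup.inf_relIndex_left, mul_comm] at h2
  rw [Nat.eq_of_mul_eq_mul_left (Nat.pos_of_ne_zero Subgroup.index_ne_zero_of_finite) h2]
  exact Subgroup.relIndex_dvd_index_of_le le_sup_left

/-- The index of (H ∩ K)N in K divides both the π-number |K:N| and the π'-number |G:H|, so it is 1.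
-/
lemma IsHallSubgroup.le_inf_sup [Finite G] {H N K : Subgroup G} (hH : IsHallSubgroup π H)
    [K.Normal] (hNK : IsPiNumber π (N.relIndex K)) : K ≤ (H ⊓ K) ⊔ N := by
  rw [← Subgroup.relIndex_eq_one]
  have h1 : ((H ⊓ K) ⊔ N).relIndex K ∣ N.relIndex K :=
    Subgroup.relIndex_dvd_of_le_left _ le_sup_right
  have h2 : ((H ⊓ K) ⊔ N).relIndex K ∣ H.index :=
    (Subgroup.relIndex_dvd_of_le_left _ le_sup_left).trans (by
      rw [Subgroup.inf_relIndex_right]; exact relIndex_dvd_index_of_normal_right H K)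
  exact Nat.eq_one_of_dvd_coprimes (hNK.coprime hH.2) h1 h2

end Hall

/-! ### Torsion in the Schur multiplier. -/

section Coclasses

variable {G : Type*} [Group G]

/-- Multiply the cocycle identity over all values z of its last argument: α^|G| is the coboundary of
x ↦ ∏ α(x, z). -/
lemma H2.pow_card_eq_one [Finite G] (c : H2 G) : c ^ Nat.card G = 1 := by
  obtain ⟨α, rfl⟩ := QuotientGroup.mk_surjective c
  rw [← QuotientGroup.mk_pow, QuotientGroup.eq_one_iff]
  have := Fintype.ofFinite G
  refine ⟨fun x => ∏ z, α.1 x z, Subtype.ext ?_⟩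
  funext x y
  show (∏ z, α.1 x z) * (∏ z, α.1 y z) / (∏ z, α.1 (x * y) z) = α.1 x y ^ Nat.card G
  rw [div_eq_iff_eq_mul]
  have h := Finset.prod_congr (rfl : (Finset.univ : Finset G) = Finset.univ)
    (fun z _ => α.2 x y z)
  rw [Finset.prod_mul_distrib, Finset.prod_mul_distrib, Finset.prod_const, Finset.card_univ,
    ← Nat.card_eq_fintype_card, Fintype.prod_equiv (Equiv.mulLeft y) (fun z => α.1 x (y * z))
      (fun z => α.1 x z) (fun _ => rfl)] at h
  rw [h, mul_comm]

lemma Z2.coclass_res (J : Subgroup G) (α : Z2 G) :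
    Z2.coclass (Z2.res J α) = H2.res J (Z2.coclass α) := rfl

variable {α : Z2 G} {V : Type*} [AddCommGroup V] [Module ℂ V]

/-- Taking determinants in ρ(x)ρ(y) = α(x,y)ρ(xy) exhibits α^dim V as the coboundary of det ρ. This
controls the order of the coclass of each tensor factor. -/
lemma TwistedRep.coclass_pow_finrank (ρ : TwistedRep α V) :
    Z2.coclass α ^ Module.finrank ℂ V = 1 := by
  rw [Z2.coclass, ← QuotientGroup.mk_pow, QuotientGroup.eq_one_iff]
  refine ⟨fun x => Units.map LinearMap.det (ρ.toFun x), Subtype.ext ?_⟩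
  funext x y
  show _ * _ / _ = α.1 x y ^ Module.finrank ℂ V
  rw [div_eq_iff_eq_mul]
  ext
  have h := congrArg (fun u : LinearMap.GeneralLinearGroup ℂ V => LinearMap.det (u : V →ₗ[ℂ] V))
    (ρ.map_mul x y)
  simpa [Units.smul_def] using h

lemma TwistedRep.isOrdinary_of_coclass_eq_one (ρ : TwistedRep α V) (h : Z2.coclass α = 1) :
    ρ.IsOrdinary := by
  obtain ⟨ζ, hζ⟩ := (QuotientGroup.eq_one_iff α).1 h
  have hα : ∀ x y, α.1 x y = ζ x * ζ y / ζ (x * y) := fun x y => by rw [← hζ]; rfl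
  refine ⟨⟨⟨fun g => ((ζ g)⁻¹ : ℂˣ) • ρ.act g, ?_⟩, ?_⟩, fun g => (ζ g)⁻¹, fun g => rfl⟩
  · ext v
    simp [Units.smul_def, act_one, hα, smul_smul]
  · intro x y
    ext v
    simp only [Units.smul_def, LinearMap.smul_apply, Module.End.mul_apply, map_smul, act_act, hα,
      smul_smul, ← Units.val_mul]
    rw [show (ζ (x * y))⁻¹ = (ζ y)⁻¹ * (ζ x)⁻¹ * (ζ x * ζ y / ζ (x * y)) by
      rw [← mul_div_assoc, mul_assoc, inv_mul_cancel_left, inv_mul_cancel, one_div],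
      mul_assoc]

end Coclasses

/-! ### Maps multiplicative up to scalars; simplicity and primitivity. -/

section ProjectiveMaps

variable {G : Type*} [Group G] {V : Type*} [AddCommGroup V] [Module ℂ V]

/-- `φ : G → GL(V)` is multiplicative up to scalars. -/
def IsProjective (φ : G → LinearMap.GeneralLinearGroup ℂ V) : Prop :=
  ∀ x y : G, ∃ c : ℂˣ, φ x * φ y = c • φ (x * y)

/-- The subspace `U` is mapped to itself by all `φ g` with `g ∈ J`. -/
def IsStable (φ : G → LinearMap.GeneralLinearGroup ℂ V) (J : Subgroup G)
    (U : Submodule ℂ V) : Prop :=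
  ∀ g ∈ J, ∀ u ∈ U, (φ g : V →ₗ[ℂ] V) u ∈ U

/-- The only subspaces stable under `G` are `0` and `V`, and `V ≠ 0`. -/
def IsSimple (φ : G → LinearMap.GeneralLinearGroup ℂ V) : Prop :=
  Nontrivial V ∧ ∀ U : Submodule ℂ V, IsStable φ ⊤ U → U = ⊥ ∨ U = ⊤

/-- `φ` is not induced from a proper subgroup: there is no nonzero subspace stable under a proper
subgroup `J` whose dimension is that of `V` divided by the index of `J`. -/
def IsPrimitive (φ : G → LinearMap.GeneralLinearGroup ℂ V) : Prop :=
  ∀ (J : Subgroup G) (U : Submodule ℂ V), U ≠ ⊥ → IsStable φ J U →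
    Module.finrank ℂ V = J.index * Module.finrank ℂ U → J = ⊤

lemma TwistedRep.isProjective {α : Z2 G} (ρ : TwistedRep α V) : IsProjective ρ.toFun :=
  fun x y => ⟨α.1 x y, ρ.map_mul x y⟩

lemma TwistedRep.IsIrreducible.isSimple {α : Z2 G} {ρ : TwistedRep α V} (h : ρ.IsIrreducible) :
    IsSimple ρ.toFun :=
  ⟨h.1, fun U hU => h.2 U fun g w hw => hU g trivial w hw⟩

end ProjectiveMaps

/-! ### Frobenius reciprocity and reduction to primitive representations. -/

namespace TwistedRep

variable {G : Type*} [Group G] {α : Z2 G} {J : Subgroup G} {U V : Type*} [AddCommGroup U]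
  [Module ℂ U] [AddCommGroup V] [Module ℂ V]

/-- The restriction of `ρ` to a subgroup `J`, acting on a `J`-stable subspace. -/
def subrep (ρ : TwistedRep α V) (J : Subgroup G) (U : Submodule ℂ V)
    (hU : IsStable ρ.toFun J U) : TwistedRep (Z2.res J α) U :=
  ofEnd _ (fun h => (ρ.act h).restrict (hU h h.2))
    (fun v => Subtype.ext (ρ.act_one v.1))
    (fun x y v => Subtype.ext (ρ.act_act x y v.1))

lemma subrep_act_coe (ρ : TwistedRep α V) (U : Submodule ℂ V)
    (hU : IsStable ρ.toFun J U) (h : J) (u : U) :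
    ((ρ.subrep J U hU).act h u : V) = ρ.act h u := rfl

/-- Frobenius reciprocity: a `J`-linear map from `U` to `V` extends to the induced module. -/
def indLift (τ : TwistedRep (Z2.res J α) U) (ρ : TwistedRep α V) (j : U →ₗ[ℂ] V)
    (hj : ∀ (h : J) (u : U), j (τ.act h u) = ρ.act h (j u)) : IndSpace τ →ₗ[ℂ] V :=
  (indRel τ).liftQ (Finsupp.lsum ℂ fun g => ρ.act g ∘ₗ j) (by
    refine Submodule.span_le.2 ?_
    rintro _ ⟨g, h, w, rfl⟩
    change _ = (0 : V)
    rw [map_sub, map_smul, Finsupp.lsum_single, Finsupp.lsum_single, LinearMap.comp_apply,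
      LinearMap.comp_apply, hj, act_act, sub_self])

section IndLift

variable {τ : TwistedRep (Z2.res J α) U} {ρ : TwistedRep α V} {j : U →ₗ[ℂ] V}
  (hj : ∀ (h : J) (u : U), j (τ.act h u) = ρ.act h (j u))

lemma indLift_single (g : G) (u : U) :
    indLift τ ρ j hj (Submodule.Quotient.mk (Finsupp.single g u)) = ρ.act g (j u) := by
  rw [indLift]
  exact (Submodule.liftQ_apply _ _ _).trans (Finsupp.lsum_single ..)

lemma ind_act_single (x g : G) (u : U) :
    τ.ind.act x (Submodule.Quotient.mk (Finsupp.single g u)) =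
      (α.1 x g : ℂ) • Submodule.Quotient.mk (Finsupp.single (x * g) u) := by
  rw [← Submodule.Quotient.mk_smul, ← indPre_single]
  rfl

lemma indSpace_induction {P : IndSpace τ → Prop} (t : IndSpace τ) (h0 : P 0)
    (hadd : ∀ a b, P a → P b → P (a + b))
    (hs : ∀ g u, P (Submodule.Quotient.mk (Finsupp.single g u))) : P t := by
  induction t using Submodule.Quotient.induction_on with
  | H t =>
    induction t using Finsupp.induction_linear with
    | zero => exact h0
    | add a b ha hb => exact hadd _ _ ha hb
    | single g w => exact hs g w

lemma indLift_act (x : G) (t : IndSpace τ) :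
    indLift τ ρ j hj (τ.ind.act x t) = ρ.act x (indLift τ ρ j hj t) := by
  induction t using indSpace_induction with
  | h0 => simp
  | hadd a b ha hb => simp only [map_add, ha, hb]
  | hs g u => rw [ind_act_single, map_smul, indLift_single, indLift_single, act_act]

lemma indLift_surjective (hρ : IsSimple ρ.toFun) (h0 : j ≠ 0) :
    Function.Surjective (indLift τ ρ j hj) := by
  rw [← LinearMap.range_eq_top]
  refine (hρ.2 (LinearMap.range (indLift τ ρ j hj)) ?_).resolve_left ?_
  · rintro g - _ ⟨t, rfl⟩
    exact ⟨τ.ind.act g t, indLift_act hj g t⟩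
  · intro hb
    obtain ⟨u, hu⟩ : ∃ u, j u ≠ 0 := by
      by_contra! h
      exact h0 (LinearMap.ext h)
    have h1 : ρ.act 1 (j u) ∈ LinearMap.range (indLift τ ρ j hj) := ⟨_, indLift_single hj 1 u⟩
    rw [hb, Submodule.mem_bot, act_one] at h1
    exact hu ((smul_eq_zero_iff_right (Units.ne_zero _)).1 h1)

variable (τ) in
-- Modulo the relations, g ⊗ u is a scalar multiple of q ⊗ h⁻¹u, where q = gh represents the coset
-- of g. Only the resulting upper bound for the dimension of the induced module is needed.
lemma exists_surjective_indSpace :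
    ∃ f : ((G ⧸ J) →₀ U) →ₗ[ℂ] IndSpace τ, Function.Surjective f := by
  refine ⟨Finsupp.lsum ℂ fun q => (indRel τ).mkQ ∘ₗ Finsupp.lsingle q.out, ?_⟩
  rw [← LinearMap.range_eq_top, eq_top_iff]
  rintro t -
  induction t using indSpace_induction with
  | h0 => exact zero_mem _
  | hadd a b ha hb => exact add_mem ha hb
  | hs g u =>
    obtain ⟨h, hh⟩ := QuotientGroup.mk_out_eq_mul J g
    have key : (Submodule.Quotient.mk (Finsupp.single (g * (h : G)) (τ.act h⁻¹ u)) : IndSpace τ) =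
        (α.1 (g * h) (h⁻¹ : J) : ℂ) • Submodule.Quotient.mk (Finsupp.single g u) := by
      rw [← Submodule.Quotient.mk_smul, Submodule.Quotient.eq]
      exact Submodule.subset_span ⟨g * h, h⁻¹, u, by simp⟩
    have h2 : (Submodule.Quotient.mk (Finsupp.single g u) : IndSpace τ) =
        ((α.1 (g * h) (h⁻¹ : J))⁻¹ : ℂˣ) •
          Submodule.Quotient.mk (Finsupp.single (g * (h : G)) (τ.act h⁻¹ u)) := by
      rw [key, Units.smul_def, smul_smul, ← Units.val_mul, inv_mul_cancel, Units.val_one, one_smul]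
    rw [h2]
    refine Submodule.smul_mem _ _ ⟨Finsupp.single (g : G ⧸ J) (τ.act h⁻¹ u), ?_⟩
    simp [hh]

variable [Finite G] [FiniteDimensional ℂ U]

variable (τ) in
lemma finiteDimensional_indSpace : FiniteDimensional ℂ (IndSpace τ) := by
  obtain ⟨f, hf⟩ := exists_surjective_indSpace τ
  exact Module.Finite.of_surjective f hf

variable (τ) in
lemma finrank_indSpace_le : Module.finrank ℂ (IndSpace τ) ≤ J.index * Module.finrank ℂ U := by
  have := Fintype.ofFinite (G ⧸ J)
  obtain ⟨f, hf⟩ := exists_surjective_indSpace τ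
  have h := LinearMap.finrank_le_finrank_of_surjective hf
  rw [(Finsupp.linearEquivFunOnFinite ℂ U (G ⧸ J)).finrank_eq, Module.finrank_pi_fintype,
    Finset.sum_const, Finset.card_univ, ← Nat.card_eq_fintype_card] at h
  exact h

include hj in
lemma finrank_le_index_mul (hρ : IsSimple ρ.toFun) (h0 : j ≠ 0) :
    Module.finrank ℂ V ≤ J.index * Module.finrank ℂ U := by
  have := finiteDimensional_indSpace τ
  exact (LinearMap.finrank_le_finrank_of_surjective (indLift_surjective hj hρ h0)).trans
    (finrank_indSpace_le τ)

include hj in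
-- The map from the induced module is onto because `ρ` is simple, and it is injective because the
-- induced module has dimension at most |G:J| dim U = dim V.
lemma isIsomorphic_ind (hρ : IsSimple ρ.toFun) (h0 : j ≠ 0)
    (hdim : Module.finrank ℂ V = J.index * Module.finrank ℂ U) :
    ρ.IsIsomorphic τ.ind := by
  have := finiteDimensional_indSpace τ
  have hs := indLift_surjective hj hρ h0
  have : FiniteDimensional ℂ V := Module.Finite.of_surjective _ hs
  have hd : Module.finrank ℂ (IndSpace τ) = Module.finrank ℂ V :=
    le_antisymm (hdim ▸ finrank_indSpace_le τ) (LinearMap.finrank_le_finrank_of_surjective hs)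
  have hi := (LinearMap.injective_iff_surjective_of_finrank_eq_finrank hd).2 hs
  let e : IndSpace τ ≃ₗ[ℂ] V := LinearEquiv.ofBijective (indLift τ ρ j hj) ⟨hi, hs⟩
  have he : ∀ t, e t = indLift τ ρ j hj t := fun _ => rfl
  refine ⟨e.symm, fun g v => ?_⟩
  rw [LinearEquiv.symm_apply_eq, he, indLift_act, ← he, e.apply_symm_apply]

end IndLift

/-- For `J` minimal, a nonzero stable W ≤ U satisfies |G:J| dim U = dim V ≤ |G:J| dim W, so W = U.
If `U` were induced from a proper subgroup of `J`, then by multiplicativity of the index that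
subgroup would contradict minimality. -/
theorem exists_primitive_subrep [Finite G] [FiniteDimensional ℂ V] (ρ : TwistedRep α V)
    (hρ : IsSimple ρ.toFun) :
    ∃ (J : Subgroup G) (U : Submodule ℂ V) (hU : IsStable ρ.toFun J U), U ≠ ⊥ ∧
      Module.finrank ℂ V = J.index * Module.finrank ℂ U ∧
      IsSimple (ρ.subrep J U hU).toFun ∧ IsPrimitive (ρ.subrep J U hU).toFun := by
  have := hρ.1
  let S : Set (Subgroup G) := {J | ∃ U : Submodule ℂ V, U ≠ ⊥ ∧ IsStable ρ.toFun J U ∧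
    Module.finrank ℂ V = J.index * Module.finrank ℂ U}
  obtain ⟨J, hJ⟩ := (Set.toFinite S).exists_minimal
    ⟨⊤, ⊤, top_ne_bot, fun _ _ _ _ => trivial, by simp⟩
  obtain ⟨U, hU0, hU, hdim⟩ := hJ.1
  refine ⟨J, U, hU, hU0, hdim, ⟨(Submodule.nontrivial_iff_ne_bot).2 hU0, ?_⟩, ?_⟩
  · intro W hW
    by_cases hW0 : W = ⊥
    · exact Or.inl hW0
    right
    have hW' : IsStable ρ.toFun J (W.map U.subtype) := by
      rintro g hg _ ⟨w, hw, rfl⟩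
      exact ⟨_, hW ⟨g, hg⟩ trivial w hw, rfl⟩
    have hle := finrank_le_index_mul (τ := ρ.subrep J _ hW') (ρ := ρ)
      (j := (W.map U.subtype).subtype) (fun _ _ => rfl) hρ (fun h => by
        refine hW0 (Submodule.map_injective_of_injective U.injective_subtype ?_)
        rw [← Submodule.range_subtype (W.map U.subtype), h, LinearMap.range_zero,
          Submodule.map_bot])
    rw [hdim, LinearEquiv.finrank_eq (Submodule.equivSubtypeMap U W).symm] at hle
    refine Submodule.eq_top_of_finrank_eq (le_antisymm (Submodule.finrank_le W) ?_)
    exact Nat.le_of_mul_le_mul_left hle (Nat.pos_of_ne_zero Subgroup.index_ne_zero_of_finite)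
  · intro K W hW0 hW hd
    have hmem : K.map J.subtype ∈ S := by
      refine ⟨W.map U.subtype, fun h => hW0 (Submodule.map_injective_of_injective
        U.injective_subtype (h.trans (Submodule.map_bot _).symm)), ?_, ?_⟩
      · rintro _ ⟨g, hg, rfl⟩ _ ⟨w, hw, rfl⟩
        exact ⟨_, hW g hg w hw, rfl⟩
      · rw [LinearEquiv.finrank_eq (Submodule.equivSubtypeMap U W).symm,
          Subgroup.index_map_subtype, hdim, hd]
        ring
    have h := hJ.2 hmem (Subgroup.map_subtype_le K)
    refine eq_top_iff.2 fun x _ => ?_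
    obtain ⟨y, hy, hxy⟩ := h x.2
    rwa [← Subtype.ext hxy]

end TwistedRep

/-! ### Operators commuting with everything. -/

section Scalars

variable {V : Type*} [AddCommGroup V] [Module ℂ V]

lemma exists_dual_apply_eq_one [Nontrivial V] : ∃ (v : V) (f : V →ₗ[ℂ] ℂ), f v = 1 := by
  obtain ⟨v, hv⟩ := exists_ne (0 : V)
  obtain ⟨f, hf⟩ := Module.Projective.exists_dual_eq_one ℂ hv
  exact ⟨v, f, hf⟩

/-- With f(v) = 1, commute T with the rank-one operator x ↦ f(x)w and evaluate at v: this gives T w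
= f(T v) w. -/
lemma exists_eq_smul_one_of_commute [Nontrivial V] {T : Module.End ℂ V}
    (h : ∀ A : Module.End ℂ V, T * A = A * T) : ∃ c : ℂ, T = c • 1 := by
  obtain ⟨v, f, hf⟩ := exists_dual_apply_eq_one (V := V)
  refine ⟨f (T v), LinearMap.ext fun w => ?_⟩
  have h1 := LinearMap.congr_fun (h (f.smulRight w)) v
  simpa [hf] using h1

lemma commute_of_span_eq_top {s : Set (Module.End ℂ V)} (hs : Submodule.span ℂ s = ⊤)
    {T : Module.End ℂ V} (h : ∀ A ∈ s, T * A = A * T) (A : Module.End ℂ V) : T * A = A * T := by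
  have hA : A ∈ Submodule.span ℂ s := hs ▸ Submodule.mem_top
  induction hA using Submodule.span_induction with
  | mem x hx => exact h x hx
  | zero => simp
  | add x y _ _ hx hy => rw [mul_add, add_mul, hx, hy]
  | smul c x _ hx => rw [mul_smul_comm, smul_mul_assoc, hx]

end Scalars

/-! ### Calculus up to scalars and Schur orthogonality. -/

section ProjectiveMaps

variable {G : Type*} [Group G] {V : Type*} [AddCommGroup V] [Module ℂ V]
  {φ : G → LinearMap.GeneralLinearGroup ℂ V}

lemma GL.coe_smul (c : ℂˣ) (u : LinearMap.GeneralLinearGroup ℂ V) :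
    ((c • u : LinearMap.GeneralLinearGroup ℂ V) : Module.End ℂ V) = (c : ℂ) • (u : Module.End ℂ V) :=
  rfl

instance GL.isScalarTower : IsScalarTower ℂˣ (LinearMap.GeneralLinearGroup ℂ V)
    (LinearMap.GeneralLinearGroup ℂ V) :=
  ⟨fun c u w => Units.ext (smul_mul_assoc (c : ℂ) (u : Module.End ℂ V) w)⟩

instance GL.smulCommClass : SMulCommClass ℂˣ (LinearMap.GeneralLinearGroup ℂ V)
    (LinearMap.GeneralLinearGroup ℂ V) :=
  ⟨fun c u w => Units.ext (mul_smul_comm (c : ℂ) (u : Module.End ℂ V) w).symm⟩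

lemma GL.inv_smul (c : ℂˣ) (u : LinearMap.GeneralLinearGroup ℂ V) :
    (c • u)⁻¹ = c⁻¹ • u⁻¹ := by
  refine inv_eq_of_mul_eq_one_right ?_
  rw [smul_mul_smul_comm, mul_inv_cancel, mul_inv_cancel, one_smul]

lemma IsProjective.exists_one (hφ : IsProjective φ) : ∃ c : ℂˣ, φ 1 = c • 1 := by
  obtain ⟨c, hc⟩ := hφ 1 1
  rw [mul_one, ← smul_one_mul c (φ 1)] at hc
  exact ⟨c, mul_right_cancel hc⟩

lemma IsProjective.exists_inv (hφ : IsProjective φ) (x : G) :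
    ∃ c : ℂˣ, (φ x)⁻¹ = c • φ x⁻¹ := by
  obtain ⟨a, ha⟩ := hφ.exists_one
  obtain ⟨b, hb⟩ := hφ x x⁻¹
  rw [mul_inv_cancel, ha, smul_smul] at hb
  refine ⟨(b * a)⁻¹, inv_eq_of_mul_eq_one_right ?_⟩
  rw [mul_smul_comm, hb, smul_smul, inv_mul_cancel, one_smul]

lemma IsProjective.smul (hφ : IsProjective φ) (c : G → ℂˣ) : IsProjective fun g => c g • φ g := by
  intro x y
  obtain ⟨a, ha⟩ := hφ x y
  refine ⟨c x * c y * a * (c (x * y))⁻¹, ?_⟩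
  dsimp only
  rw [smul_mul_smul_comm, ha, smul_smul, smul_smul, inv_mul_cancel_right]

lemma IsProjective.restrict (hφ : IsProjective φ) (K : Subgroup G) :
    IsProjective fun k : K => φ k :=
  fun x y => hφ x y

lemma pow_finrank_eq_one_of_det {u w : LinearMap.GeneralLinearGroup ℂ V} {c : ℂˣ} (h : u = c • w)
    (hu : LinearMap.det (u : Module.End ℂ V) = 1) (hw : LinearMap.det (w : Module.End ℂ V) = 1) :
    (c : ℂ) ^ Module.finrank ℂ V = 1 := by
  rwa [h, GL.coe_smul, LinearMap.det_smul, hw, mul_one] at hu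

lemma exists_smul_det_eq_one [FiniteDimensional ℂ V] [Nontrivial V]
    (u : LinearMap.GeneralLinearGroup ℂ V) :
    ∃ c : ℂˣ, LinearMap.det ((c • u : LinearMap.GeneralLinearGroup ℂ V) : Module.End ℂ V) = 1 := by
  have hd : LinearMap.det (u : Module.End ℂ V) ≠ 0 :=
    ((Units.isUnit u).map (LinearMap.det : (V →ₗ[ℂ] V) →* ℂ)).ne_zero
  obtain ⟨z, hz⟩ := IsAlgClosed.exists_pow_nat_eq (LinearMap.det (u : Module.End ℂ V))⁻¹
    (Module.finrank_pos (R := ℂ) (M := V))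
  have hz0 : z ≠ 0 := by
    rintro rfl
    rw [zero_pow (Module.finrank_pos (R := ℂ) (M := V)).ne'] at hz
    exact inv_ne_zero hd hz.symm
  refine ⟨Units.mk0 z hz0, ?_⟩
  rw [GL.coe_smul, LinearMap.det_smul, Units.val_mk0, hz, inv_mul_cancel₀ hd]

/-- Schur orthogonality, in the form of an identity of operators. -/
lemma sum_trace_inv_smul [Fintype G] [FiniteDimensional ℂ V] [Nontrivial V]
    (hφ : IsProjective φ)
    (hs : Submodule.span ℂ (Set.range fun g => (φ g : Module.End ℂ V)) = ⊤) :
    ∑ g, LinearMap.trace ℂ V ((φ g)⁻¹ : LinearMap.GeneralLinearGroup ℂ V).val •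
      (φ g : Module.End ℂ V) =
      ((Fintype.card G : ℂ) / Module.finrank ℂ V) • 1 := by
  have hd : (Module.finrank ℂ V : ℂ) ≠ 0 :=
    Nat.cast_ne_zero.2 (Module.finrank_pos (R := ℂ) (M := V)).ne'
  -- The average of the conjugates of A is fixed by every conjugation, since the scalars from φ and
  -- φ⁻¹ cancel. It therefore commutes with the spanning set and is scalar; its trace determines the
  -- scalar.
  have havg : ∀ A : Module.End ℂ V,
      ∑ g, ((φ g)⁻¹ : LinearMap.GeneralLinearGroup ℂ V).val * A * (φ g).val =
        ((Fintype.card G : ℂ) / Module.finrank ℂ V * LinearMap.trace ℂ V A) • 1 := by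
    intro A
    set T : Module.End ℂ V :=
      ∑ g, ((φ g)⁻¹ : LinearMap.GeneralLinearGroup ℂ V).val * A * (φ g).val with hT
    have hconj : ∀ h, ((φ h)⁻¹ : LinearMap.GeneralLinearGroup ℂ V).val * T * (φ h).val = T := by
      intro h
      rw [hT, Finset.mul_sum, Finset.sum_mul]
      refine Fintype.sum_equiv (Equiv.mulRight h) _ _ fun g => ?_
      obtain ⟨c, hc⟩ := hφ g h
      have h1 : φ (g * h) = c⁻¹ • (φ g * φ h) := by rw [hc, smul_smul, inv_mul_cancel, one_smul]
      rw [Equiv.coe_mulRight, h1, GL.inv_smul, GL.coe_smul, GL.coe_smul, smul_mul_assoc,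
        smul_mul_assoc, mul_smul_comm, smul_smul, ← Units.val_mul, inv_inv, mul_inv_cancel,
        Units.val_one, one_smul, mul_inv_rev, Units.val_mul, Units.val_mul]
      simp only [mul_assoc]
    obtain ⟨c, hc⟩ := exists_eq_smul_one_of_commute (commute_of_span_eq_top hs (T := T) (by
      rintro _ ⟨h, rfl⟩
      conv_rhs => rw [← hconj h]
      rw [← mul_assoc, ← mul_assoc, ← Units.val_mul, mul_inv_cancel, Units.val_one, one_mul]))
    have htr := congrArg (LinearMap.trace ℂ V) hT
    rw [hc, map_smul, LinearMap.trace_one, map_sum] at htr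
    have h2 : ∀ g, LinearMap.trace ℂ V
        (((φ g)⁻¹ : LinearMap.GeneralLinearGroup ℂ V).val * A * (φ g).val) =
        LinearMap.trace ℂ V A := by
      intro g
      rw [LinearMap.trace_mul_comm, ← mul_assoc, ← Units.val_mul, mul_inv_cancel, Units.val_one,
        one_mul]
    simp only [h2, Finset.sum_const, Finset.card_univ, nsmul_eq_mul, smul_eq_mul] at htr
    rw [hc]
    congr 1
    field_simp
    exact htr
  let b := Module.finBasis ℂ V
  refine LinearMap.ext fun w => ?_
  refine sub_eq_zero.1 ((Module.forall_dual_apply_eq_zero_iff ℂ _).1 ?_)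
  intro f
  have htrace : ∀ X : Module.End ℂ V, LinearMap.trace ℂ V X = ∑ i, b.coord i (X (b i)) := by
    intro X
    rw [LinearMap.trace_eq_matrix_trace ℂ b, Matrix.trace]
    simp [LinearMap.toMatrix_apply]
  -- Apply the averaging identity to the rank-one operator x ↦ f(x) b_i and take the i-th
  -- coordinate; summing over i then produces the traces.
  have key : ∀ i, ∑ g, b.coord i (((φ g)⁻¹ : LinearMap.GeneralLinearGroup ℂ V).val (b i)) *
      f ((φ g).val w) =
      (Fintype.card G : ℂ) / Module.finrank ℂ V * f (b i) * b.coord i w := by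
    intro i
    have h := congrArg (b.coord i) (LinearMap.congr_fun (havg (f.smulRight (b i))) w)
    simpa [LinearMap.trace_smulRight, mul_comm, mul_left_comm] using h
  rw [map_sub, sub_eq_zero]
  simp only [LinearMap.sum_apply, LinearMap.smul_apply, map_sum, map_smul, smul_eq_mul, htrace,
    Module.End.one_apply, Finset.sum_mul]
  rw [Finset.sum_comm]
  simp only [key, mul_assoc, ← Finset.mul_sum]
  congr 1
  have h := congrArg f (b.sum_repr w)
  simp only [map_sum, map_smul, smul_eq_mul] at h
  simpa [mul_comm] using h

end ProjectiveMaps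

/-! ### Algebraic integers as eigenvalues and traces. -/

section Integrality

variable {V : Type*} [AddCommGroup V] [Module ℂ V]

lemma isIntegral_int_of_integralClosure {x : ℂ} (h : IsIntegral (integralClosure ℤ ℂ) x) :
    IsIntegral ℤ x :=
  isIntegral_trans x h

/-- A monic polynomial annihilating X also annihilates its eigenvalues; integrality over the
algebraic integers then descends to ℤ. -/
lemma isIntegral_of_hasEigenvalue {X : Module.End ℂ V}
    (hX : IsIntegral (integralClosure ℤ ℂ) X) {μ : ℂ} (hμ : X.HasEigenvalue μ) :
    IsIntegral ℤ μ := by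
  obtain ⟨p, hp, hpX⟩ := hX
  obtain ⟨v, hv⟩ := hμ.exists_hasEigenvector
  refine isIntegral_int_of_integralClosure ⟨p, hp, ?_⟩
  have h1 := Module.End.aeval_apply_of_hasEigenvector (p := p.map (algebraMap _ ℂ)) hv
  rw [Polynomial.aeval_map_algebraMap, Polynomial.aeval_def, hpX, LinearMap.zero_apply,
    Polynomial.eval_map] at h1
  exact (smul_eq_zero_iff_left hv.2).1 h1.symm

lemma isIntegral_trace [FiniteDimensional ℂ V] {X : Module.End ℂ V}
    (hX : IsIntegral (integralClosure ℤ ℂ) X) : IsIntegral ℤ (LinearMap.trace ℂ V X) := by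
  rw [Module.End.trace_eq_sum_roots_charpoly_of_splits (IsAlgClosed.splits _)]
  refine IsIntegral.multiset_sum fun μ hμ => isIntegral_of_hasEigenvalue hX ?_
  rw [Module.End.hasEigenvalue_iff_isRoot_charpoly]
  exact Polynomial.isRoot_of_mem_roots hμ

lemma dvd_of_isIntegral_div {n d : ℕ} (hd : d ≠ 0) (h : IsIntegral ℤ ((n : ℂ) / d)) : d ∣ n := by
  have h1 : IsIntegral ℤ ((n : ℚ) / d) := by
    rw [← isIntegral_algebraMap_iff (A := ℚ) (B := ℂ) (algebraMap ℚ ℂ).injective]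
    simpa using h
  obtain ⟨z, hz⟩ := IsIntegrallyClosed.isIntegral_iff.1 h1
  rw [eq_div_iff (Nat.cast_ne_zero.2 hd)] at hz
  refine Int.natCast_dvd_natCast.1 ⟨z, ?_⟩
  have : ((z * d : ℤ) : ℚ) = (n : ℤ) := by simpa using hz
  rw [mul_comm]
  exact_mod_cast this.symm

end Integrality

/-! ### The degree divides the index of a subgroup acting by scalars. -/

section ProjectiveMaps

variable {G : Type*} [Group G] {V : Type*} [AddCommGroup V] [Module ℂ V]
  {φ : G → LinearMap.GeneralLinearGroup ℂ V}

lemma card_smul_sum_quotient_out {M : Type*} [AddCommGroup M] [Fintype G] (N : Subgroup G)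
    [Fintype (G ⧸ N)] (F : G → M) (hF : ∀ g, ∀ n ∈ N, F (g * n) = F g) :
    Nat.card N • ∑ q : G ⧸ N, F q.out = ∑ g, F g := by
  have := Fintype.ofFinite N
  have hb : Function.Bijective fun p : (G ⧸ N) × N => p.1.out * (p.2 : G) := by
    constructor
    · rintro ⟨q, n⟩ ⟨r, m⟩ h
      dsimp only at h
      have hqr : q = r := by
        have h1 := congrArg (QuotientGroup.mk : G → G ⧸ N) h
        rwa [QuotientGroup.mk_mul_of_mem _ n.2, QuotientGroup.mk_mul_of_mem _ m.2,
          QuotientGroup.out_eq', QuotientGroup.out_eq'] at h1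
      subst hqr
      rw [Subtype.ext (mul_left_cancel h)]
    · intro g
      obtain ⟨n, hn⟩ := QuotientGroup.mk_out_eq_mul N g
      exact ⟨⟨g, n⁻¹⟩, by simp [hn]⟩
  rw [← hb.sum_comp, Fintype.sum_prod_type]
  simp [hF, Finset.smul_sum, Nat.card_eq_fintype_card]

/-- With determinants 1, the scalars in φ(g)φ(h) = cφ(gh) satisfy c^dim V = 1. The span over the
algebraic integers is thus a ring, finitely generated as a module, and all its elements are
integral. -/
lemma IsProjective.isIntegral_of_mem_span [Finite G] (hφ : IsProjective φ)
    [Nontrivial V] [FiniteDimensional ℂ V]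
    (hdet : ∀ g, LinearMap.det (φ g : Module.End ℂ V) = 1) {X : Module.End ℂ V}
    (hX : X ∈ Submodule.span (integralClosure ℤ ℂ)
      (Set.range fun g => (φ g : Module.End ℂ V))) : IsIntegral (integralClosure ℤ ℂ) X := by
  set S := Submodule.span (integralClosure ℤ ℂ) (Set.range fun g => (φ g : Module.End ℂ V))
  have hd := (Module.finrank_pos (R := ℂ) (M := V))
  have hsmul : ∀ c : ℂ, c ^ Module.finrank ℂ V = 1 → ∀ Y ∈ S, c • Y ∈ S := by
    intro c hc Y hY
    have h1 : IsIntegral ℤ c := IsIntegral.of_pow hd (by rw [hc]; exact isIntegral_one)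
    exact S.smul_mem (⟨c, h1⟩ : integralClosure ℤ ℂ) hY
  have hone : (1 : Module.End ℂ V) ∈ S := by
    obtain ⟨c, hc⟩ := hφ.exists_one
    have h1 : (1 : LinearMap.GeneralLinearGroup ℂ V) = c⁻¹ • φ 1 := by
      rw [hc, smul_smul, inv_mul_cancel, one_smul]
    have h2 := hsmul _ (pow_finrank_eq_one_of_det h1 (by simp) (hdet 1)) _
      (Submodule.subset_span ⟨1, rfl⟩)
    rwa [← GL.coe_smul, ← h1] at h2
  have hmul : ∀ x y, x ∈ S → y ∈ S → x * y ∈ S := by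
    intro x y hx hy
    have h := Submodule.mul_mem_mul hx hy
    rw [Submodule.span_mul_span] at h
    refine Submodule.span_le.2 ?_ h
    rintro _ ⟨_, ⟨g, rfl⟩, _, ⟨h, rfl⟩, rfl⟩
    obtain ⟨c, hc⟩ := hφ g h
    have hdet' : LinearMap.det ((φ g * φ h : LinearMap.GeneralLinearGroup ℂ V) :
        Module.End ℂ V) = 1 := by
      rw [Units.val_mul, map_mul, hdet, hdet, mul_one]
    have h2 := hsmul _ (pow_finrank_eq_one_of_det hc hdet' (hdet _)) _
      (Submodule.subset_span ⟨g * h, rfl⟩)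
    rwa [← GL.coe_smul, ← hc] at h2
  exact IsIntegral.of_mem_of_fg (S.toSubalgebra hone hmul)
    (by rw [Submodule.toSubalgebra_toSubmodule]; exact Submodule.fg_span (Set.finite_range _)) X hX

/-- The summands tr(φ(g)⁻¹)φ(g) are constant on cosets of N, since scalars cancel. Schur
orthogonality then makes their sum over G/N equal to |G:N|/dim V times the identity. That sum lies
in the integral span, so the rational number |G:N|/dim V is an algebraic integer. -/
theorem finrank_dvd_index_of_det_eq_one [Finite G] [FiniteDimensional ℂ V] [Nontrivial V]
    (hφ : IsProjective φ)
    (hs : Submodule.span ℂ (Set.range fun g => (φ g : Module.End ℂ V)) = ⊤)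
    (hdet : ∀ g, LinearMap.det (φ g : Module.End ℂ V) = 1)
    (N : Subgroup G) (hN : ∀ n ∈ N, ∃ c : ℂˣ, φ n = c • 1) :
    Module.finrank ℂ V ∣ N.index := by
  have := Fintype.ofFinite G
  have := Fintype.ofFinite (G ⧸ N)
  have hd := (Module.finrank_pos (R := ℂ) (M := V))
  set F : G → Module.End ℂ V := fun g =>
    LinearMap.trace ℂ V ((φ g)⁻¹ : LinearMap.GeneralLinearGroup ℂ V).val • (φ g : Module.End ℂ V)
    with hF
  have hFN : ∀ g, ∀ n ∈ N, F (g * n) = F g := by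
    intro g n hn
    obtain ⟨c, hc⟩ := hN n hn
    obtain ⟨a, ha⟩ := hφ g n
    have h1 : φ (g * n) = (a⁻¹ * c) • φ g := by
      have h2 : c • φ g = φ g * φ n := by rw [hc, mul_smul_comm, mul_one]
      rw [mul_smul, h2, ha, smul_smul, inv_mul_cancel, one_smul]
    simp only [hF, h1, GL.inv_smul, GL.coe_smul, map_smul, smul_smul]
    congr 1
    rw [smul_eq_mul, mul_right_comm, ← Units.val_mul, inv_mul_cancel, Units.val_one, one_mul]
  have hsum := card_smul_sum_quotient_out N F hFN
  rw [hF, sum_trace_inv_smul hφ hs, ← hF, ← Nat.card_eq_fintype_card, ← N.card_mul_index] at hsum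
  have hcard : (Nat.card N : ℂ) ≠ 0 := Nat.cast_ne_zero.2 Nat.card_pos.ne'
  have hE : ∑ q : G ⧸ N, F q.out = ((N.index : ℂ) / Module.finrank ℂ V) • 1 := by
    have h1 := congrArg (fun X : Module.End ℂ V => (Nat.card N : ℂ)⁻¹ • X) hsum
    rw [← Nat.cast_smul_eq_nsmul ℂ, smul_smul, inv_mul_cancel₀ hcard, one_smul, smul_smul] at h1
    rw [h1]
    congr 1
    push_cast
    field_simp
  have hmem : ∑ q : G ⧸ N, F q.out ∈ Submodule.span (integralClosure ℤ ℂ)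
      (Set.range fun g => (φ g : Module.End ℂ V)) := by
    refine Submodule.sum_mem _ fun q _ => ?_
    obtain ⟨c, hc⟩ := hφ.exists_inv q.out
    have hdi : LinearMap.det (((φ q.out)⁻¹ : LinearMap.GeneralLinearGroup ℂ V) :
        Module.End ℂ V) = 1 := by
      have h1 := congrArg (fun u : LinearMap.GeneralLinearGroup ℂ V =>
        LinearMap.det (u : Module.End ℂ V)) (mul_inv_cancel (φ q.out))
      simpa only [Units.val_mul, map_mul, hdet, one_mul, Units.val_one, map_one] using h1
    have hc1 : IsIntegral ℤ (c : ℂ) := IsIntegral.of_pow hd (by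
      rw [pow_finrank_eq_one_of_det hc hdi (hdet _)]; exact isIntegral_one)
    have htr : IsIntegral ℤ (LinearMap.trace ℂ V
        ((φ q.out)⁻¹ : LinearMap.GeneralLinearGroup ℂ V).val) := by
      refine isIntegral_trace (hφ.isIntegral_of_mem_span hdet ?_)
      rw [hc, GL.coe_smul]
      exact Submodule.smul_mem _ (⟨c, hc1⟩ : integralClosure ℤ ℂ)
        (Submodule.subset_span ⟨_, rfl⟩)
    exact Submodule.smul_mem _ (⟨_, htr⟩ : integralClosure ℤ ℂ)
        (Submodule.subset_span ⟨_, rfl⟩)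
  refine dvd_of_isIntegral_div hd.ne'
    (isIntegral_of_hasEigenvalue (hφ.isIntegral_of_mem_span hdet hmem) ?_)
  obtain ⟨v, hv⟩ := exists_ne (0 : V)
  refine Module.End.hasEigenvalue_of_hasEigenvector (x := v) ⟨?_, hv⟩
  rw [Module.End.mem_eigenspace_iff, hE]
  rfl

/-- The degree of an absolutely irreducible projective representation divides the index of every
subgroup that acts by scalars. -/
theorem finrank_dvd_index [Finite G] [FiniteDimensional ℂ V] [Nontrivial V]
    (hφ : IsProjective φ)
    (hs : Submodule.span ℂ (Set.range fun g => (φ g : Module.End ℂ V)) = ⊤)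
    (N : Subgroup G) (hN : ∀ n ∈ N, ∃ c : ℂˣ, φ n = c • 1) :
    Module.finrank ℂ V ∣ N.index := by
  -- Rescaling to determinant 1 changes neither the span nor which elements act by scalars.
  choose c hc using fun g => exists_smul_det_eq_one (φ g)
  refine finrank_dvd_index_of_det_eq_one (hφ.smul c) ?_ hc N fun n hn => ?_
  · rw [eq_top_iff, ← hs, Submodule.span_le]
    rintro _ ⟨g, rfl⟩
    have h1 : (φ g : Module.End ℂ V) = ((c g)⁻¹ : ℂˣ).val • (c g • φ g : _ˣ).val := by
      rw [← GL.coe_smul, smul_smul, inv_mul_cancel, one_smul]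
    dsimp only
    rw [h1]
    exact Submodule.smul_mem _ _ (Submodule.subset_span ⟨g, rfl⟩)
  · obtain ⟨a, ha⟩ := hN n hn
    exact ⟨c n * a, by simp only [ha, smul_smul]⟩

end ProjectiveMaps

/-! ### Algebras normalized by a simple or primitive representation. -/

section ProjectiveMaps

variable {G : Type*} [Group G] {V : Type*} [AddCommGroup V] [Module ℂ V]
  {φ : G → LinearMap.GeneralLinearGroup ℂ V}

/-- The subalgebra of `End V` spanned by the operators `φ k` with `k ∈ K`. -/
def IsProjective.spanAlgebra (hφ : IsProjective φ) (K : Subgroup G) :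
    Subalgebra ℂ (Module.End ℂ V) :=
  (Submodule.span ℂ (Set.range fun k : K => (φ k : Module.End ℂ V))).toSubalgebra
    (by
      obtain ⟨c, hc⟩ := hφ.exists_one
      have h1 : (1 : Module.End ℂ V) = (c⁻¹ : ℂˣ).val • (φ 1 : Module.End ℂ V) := by
        rw [← GL.coe_smul, hc, smul_smul, inv_mul_cancel, one_smul, Units.val_one]
      rw [h1]
      exact Submodule.smul_mem _ _ (Submodule.subset_span ⟨1, rfl⟩))
    (by
      intro x y hx hy
      have h := Submodule.mul_mem_mul hx hy
      rw [Submodule.span_mul_span] at h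
      refine Submodule.span_le.2 ?_ h
      rintro _ ⟨_, ⟨k, rfl⟩, _, ⟨l, rfl⟩, rfl⟩
      obtain ⟨c, hc⟩ := hφ k l
      dsimp only
      rw [← Units.val_mul, hc, GL.coe_smul]
      exact Submodule.smul_mem _ _ (Submodule.subset_span ⟨k * l, rfl⟩))

lemma IsProjective.mem_spanAlgebra (hφ : IsProjective φ) {K : Subgroup G} {k : G} (hk : k ∈ K) :
    (φ k : Module.End ℂ V) ∈ hφ.spanAlgebra K :=
  Submodule.subset_span (⟨⟨k, hk⟩, rfl⟩ : _ ∈ Set.range fun k : K => (φ k : Module.End ℂ V))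

lemma IsProjective.conj_mem_spanAlgebra (hφ : IsProjective φ) (K : Subgroup G) [K.Normal] (g : G)
    {X : Module.End ℂ V} (hX : X ∈ hφ.spanAlgebra K) :
    (φ g).val * X * ((φ g)⁻¹ : LinearMap.GeneralLinearGroup ℂ V).val ∈ hφ.spanAlgebra K := by
  refine Submodule.span_induction (p := fun X _ => (φ g).val * X *
    ((φ g)⁻¹ : LinearMap.GeneralLinearGroup ℂ V).val ∈ hφ.spanAlgebra K) ?_ ?_ ?_ ?_ hX
  · rintro _ ⟨k, rfl⟩
    obtain ⟨a, ha⟩ := hφ g k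
    obtain ⟨b, hb⟩ := hφ.exists_inv g
    obtain ⟨c, hc⟩ := hφ (g * k) g⁻¹
    dsimp only
    rw [← Units.val_mul, ← Units.val_mul, ha, hb, smul_mul_smul_comm, hc, smul_smul, GL.coe_smul]
    exact Subalgebra.smul_mem _ (hφ.mem_spanAlgebra (Subgroup.Normal.conj_mem inferInstance _ k.2 g)) _
  · rw [mul_zero, zero_mul]
    exact zero_mem _
  · intro x y _ _ hx hy
    rw [mul_add, add_mul]
    exact add_mem hx hy
  · intro c x _ hx
    rw [mul_smul_comm, smul_mul_assoc]
    exact Subalgebra.smul_mem _ hx _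

lemma IsProjective.conj_inv_mem_spanAlgebra (hφ : IsProjective φ) (K : Subgroup G) [K.Normal]
    (g : G) {X : Module.End ℂ V} (hX : X ∈ hφ.spanAlgebra K) :
    ((φ g)⁻¹ : LinearMap.GeneralLinearGroup ℂ V).val * X * (φ g).val ∈ hφ.spanAlgebra K := by
  obtain ⟨c, hc⟩ := hφ.exists_inv g
  have h1 : φ g = c⁻¹ • (φ g⁻¹)⁻¹ := by rw [← inv_inv (φ g), hc, GL.inv_smul]
  have h := hφ.conj_mem_spanAlgebra K g⁻¹ hX
  rw [hc, h1]
  rw [GL.coe_smul, GL.coe_smul, smul_mul_assoc, smul_mul_smul_comm, ← Units.val_mul,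
    mul_inv_cancel, Units.val_one, one_smul]
  exact h

/-- Conjugation by `φ g` on the algebra spanned by the image of a normal subgroup. -/
def IsProjective.conjAlgEquiv (hφ : IsProjective φ) (K : Subgroup G) [K.Normal] (g : G) :
    hφ.spanAlgebra K ≃ₐ[ℂ] hφ.spanAlgebra K :=
  AlgEquiv.ofLinearEquiv
    { toFun := fun X => ⟨_, hφ.conj_mem_spanAlgebra K g X.2⟩
      invFun := fun X => ⟨_, hφ.conj_inv_mem_spanAlgebra K g X.2⟩
      map_add' := fun X Y => Subtype.ext (by simp [mul_add, add_mul])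
      map_smul' := fun c X => Subtype.ext (by simp)
      left_inv := fun X => Subtype.ext (by
        simp only [← mul_assoc, Units.inv_mul, one_mul]
        rw [mul_assoc, Units.inv_mul, mul_one])
      right_inv := fun X => Subtype.ext (by
        simp only [← mul_assoc, Units.mul_inv, one_mul]
        rw [mul_assoc, Units.mul_inv, mul_one]) }
    (Subtype.ext (by simp))
    (fun X Y => Subtype.ext (by
      show (φ g).val * (X * Y) * _ = _ * _
      simp only [mul_assoc, LinearEquiv.coe_mk, LinearMap.coe_mk, AddHom.coe_mk]
      rw [← mul_assoc _ (φ g).val, Units.inv_mul, one_mul]))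

lemma IsProjective.coe_conjAlgEquiv (hφ : IsProjective φ) (K : Subgroup G) [K.Normal] (g : G)
    (X : hφ.spanAlgebra K) : (hφ.conjAlgEquiv K g X : Module.End ℂ V) =
      (φ g).val * X * ((φ g)⁻¹ : LinearMap.GeneralLinearGroup ℂ V).val := rfl

lemma IsProjective.conjAlgEquiv_mul (hφ : IsProjective φ) (K : Subgroup G) [K.Normal] (g : G)
    (X : hφ.spanAlgebra K) : (hφ.conjAlgEquiv K g X : Module.End ℂ V) * (φ g).val =
      (φ g).val * X := by
  rw [hφ.coe_conjAlgEquiv, mul_assoc, Units.inv_mul, mul_one]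

/-- The Jacobson radical R of E is preserved by the automorphisms `c g`, so RV is stable under G. By
Nakayama RV ≠ V, hence RV = 0, and R = 0 because E acts faithfully. -/
theorem isSemisimpleRing_of_isSimple [FiniteDimensional ℂ V] (hs : IsSimple φ)
    (E : Subalgebra ℂ (Module.End ℂ V)) (c : G → E ≃ₐ[ℂ] E)
    (hc : ∀ g (X : E), (c g X : Module.End ℂ V) * (φ g).val = (φ g).val * X) :
    IsSemisimpleRing E := by
  have := hs.1
  have : IsArtinianRing E := IsArtinianRing.of_finite ℂ _
  have : Module.Finite E V := Module.Finite.of_restrictScalars_finite ℂ _ _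
  rw [IsArtinianRing.isSemisimpleRing_iff_jacobson]
  set R := Ring.jacobson E
  have hlt : R • (⊤ : Submodule E V) < ⊤ := Submodule.jacobson_smul_lt_top _
  have hst : IsStable φ ⊤ ((R • (⊤ : Submodule E V)).restrictScalars ℂ) := by
    intro g _ u hu
    rw [Submodule.restrictScalars_mem] at hu ⊢
    refine Submodule.smul_induction_on hu (fun r hr v _ => ?_) (fun x y hx hy => ?_)
    · have : RingHomSurjective ((c g : E →ₐ[ℂ] E) : E →+* E) := ⟨(c g).surjective⟩
      have h1 : c g r ∈ R := Ring.le_comap_jacobson ((c g : E →ₐ[ℂ] E) : E →+* E) hr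
      have h2 : (φ g).val (r • v) = c g r • (φ g).val v := (LinearMap.congr_fun (hc g r) v).symm
      rw [h2]
      exact Submodule.smul_mem_smul h1 Submodule.mem_top
    · rw [map_add]
      exact add_mem hx hy
  rcases hs.2 _ hst with h | h
  · rw [eq_bot_iff]
    intro r hr
    rw [Submodule.mem_bot]
    refine Subtype.ext (LinearMap.ext fun v => ?_)
    have h1 : r • v ∈ R • (⊤ : Submodule E V) := Submodule.smul_mem_smul hr Submodule.mem_top
    rw [← Submodule.restrictScalars_mem ℂ, h, Submodule.mem_bot] at h1
    exact h1
  · rw [Submodule.restrictScalars_eq_top_iff] at h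
    exact absurd h hlt.ne

/-- A primitive representation permuting the members of an independent family of subspaces
stabilizes all of them, so that only one of them is nonzero. -/
theorem IsProjective.eq_top_of_iSupIndep [Finite G] [FiniteDimensional ℂ V] (hφ : IsProjective φ)
    (hs : IsSimple φ) (hp : IsPrimitive φ) {X : Type*} (W : X → Submodule ℂ V)
    (hW : iSupIndep W) (hperm : ∀ g x, ∃ y, (W x).map (φ g : V →ₗ[ℂ] V) = W y) (x : X)
    (hx : W x ≠ ⊥) : W x = ⊤ := by
  -- Nonzero scalars fix every subspace, so φ gives a genuine action on subspaces.
  let _ : MulAction G (Submodule ℂ V) :=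
    { smul := fun g U => U.map (φ g : V →ₗ[ℂ] V)
      one_smul := fun U => by
        obtain ⟨c, hc⟩ := hφ.exists_one
        show U.map (φ 1 : V →ₗ[ℂ] V) = U
        rw [hc, GL.coe_smul]
        exact (Submodule.map_smul _ _ _ c.ne_zero).trans (Submodule.map_id U)
      mul_smul := fun g h U => by
        obtain ⟨c, hc⟩ := hφ g h
        show U.map (φ (g * h) : V →ₗ[ℂ] V) = (U.map (φ h : V →ₗ[ℂ] V)).map (φ g : V →ₗ[ℂ] V)
        rw [← Submodule.map_comp]
        change _ = U.map ((φ g * φ h : LinearMap.GeneralLinearGroup ℂ V) : V →ₗ[ℂ] V)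
        rw [hc, GL.coe_smul]
        exact (Submodule.map_smul _ _ _ c.ne_zero).symm }
  set O := MulAction.orbit G (W x) with hO
  have hy : ∀ o : O, ∃ y, W y = o := by
    rintro ⟨_, g, rfl⟩
    obtain ⟨y, hy⟩ := hperm g x
    exact ⟨y, hy.symm⟩
  choose y hy using hy
  have hind : iSupIndep (fun o : O => (o : Submodule ℂ V)) := by
    have := hW.comp (f := y) (fun a b hab => Subtype.ext (by rw [← hy, ← hy, hab]))
    convert this using 2
    exact (hy _).symm
  have hfin : Finite O := Finite.Set.finite_range _
  have := Fintype.ofFinite O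
  have htop : ⨆ o : O, (o : Submodule ℂ V) = ⊤ := by
    refine (hs.2 _ ?_).resolve_left ?_
    · intro g _ u hu
      have h1 : (φ g : V →ₗ[ℂ] V) u ∈ (⨆ o : O, (o : Submodule ℂ V)).map (φ g : V →ₗ[ℂ] V) :=
        ⟨u, hu, rfl⟩
      rw [Submodule.map_iSup] at h1
      refine (iSup_le fun o => ?_ : _ ≤ ⨆ o : O, (o : Submodule ℂ V)) h1
      exact le_iSup (fun o : O => (o : Submodule ℂ V))
        (⟨g • o.1, MulAction.mem_orbit_of_mem_orbit g o.2⟩)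
    · intro h
      exact hx (le_bot_iff.1 (h ▸ le_iSup (fun o : O => (o : Submodule ℂ V))
        ⟨W x, MulAction.mem_orbit_self _⟩))
  have hint := DirectSum.isInternal_submodule_of_iSupIndep_of_iSup_eq_top hind htop
  -- The orbit of `W x` decomposes V into summands of equal dimension, and its length is the index
  -- of the stabilizer. Primitivity forces the stabilizer to be all of G.
  have hdim : Module.finrank ℂ V = Nat.card O * Module.finrank ℂ (W x) := by
    classical
    rw [← (LinearEquiv.ofBijective (DirectSum.coeLinearMap fun o : O => (o : Submodule ℂ V))
      hint).finrank_eq, Module.finrank_directSum, Finset.sum_congr rfl (g := fun _ =>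
        Module.finrank ℂ (W x)), Finset.sum_const, Finset.card_univ, Nat.card_eq_fintype_card,
        smul_eq_mul]
    rintro ⟨_, g, rfl⟩ -
    exact (LinearEquiv.finrank_eq
      ((LinearMap.GeneralLinearGroup.generalLinearEquiv ℂ V (φ g)).submoduleMap (W x))).symm
  have hidx := MulAction.index_stabilizer G (W x)
  rw [← hO, ← Nat.card_coe_set_eq] at hidx
  have hstab := hp (MulAction.stabilizer G (W x)) (W x) hx (fun g hg u hu => by
      have h1 : g • W x = W x := hg
      rw [← h1]
      exact ⟨u, hu, rfl⟩) (by rw [hdim, hidx])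
  rw [hstab, Subgroup.index_top] at hidx
  rw [← hidx, one_mul] at hdim
  exact Submodule.eq_top_of_finrank_eq hdim.symm

end ProjectiveMaps

/-! ### The centre of a normalized algebra under primitivity. -/

section ProjectiveMaps

variable {G : Type*} [Group G] {V : Type*} [AddCommGroup V] [Module ℂ V]
  {φ : G → LinearMap.GeneralLinearGroup ℂ V}

lemma sub_smul_one_pow_apply {z : Module.End ℂ V} {a : ℂ} {u : V} (h : z u = a • u) (c : ℂ)
    (k : ℕ) : ((z - c • 1) ^ k) u = (a - c) ^ k • u := by
  induction k with
  | zero => simp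
  | succ k ih =>
    rw [pow_succ, Module.End.mul_apply, LinearMap.sub_apply, h, LinearMap.smul_apply,
      Module.End.one_apply, ← sub_smul, map_smul, ih, smul_smul, pow_succ']

/-- An idempotent different from 0 and 1 has both eigenvalues 0 and 1, whereas `c` is its only
generalized eigenvalue. -/
lemma eq_zero_or_one_of_isIdempotentElem {z : Module.End ℂ V} (hz : z * z = z) {c : ℂ}
    (h : ∀ v, ∃ k : ℕ, ((z - c • 1) ^ k) v = 0) : z = 0 ∨ z = 1 := by
  have hz' : ∀ v, z (z v) = z v := fun v => LinearMap.congr_fun hz v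
  by_contra! hne
  obtain ⟨v, hv⟩ : ∃ v, z v ≠ 0 := by
    by_contra! h0
    exact hne.1 (LinearMap.ext h0)
  obtain ⟨w, hw⟩ : ∃ w, z w ≠ w := by
    by_contra! h0
    exact hne.2 (LinearMap.ext h0)
  obtain ⟨k, hk⟩ := h (z v)
  obtain ⟨l, hl⟩ := h (z w - w)
  rw [sub_smul_one_pow_apply (a := 1) (by rw [hz', one_smul])] at hk
  rw [sub_smul_one_pow_apply (a := 0) (by rw [map_sub, hz', sub_self, zero_smul])] at hl
  have h1 := eq_zero_of_pow_eq_zero (smul_eq_zero_iff_left hv |>.1 hk)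
  have h2 := eq_zero_of_pow_eq_zero (smul_eq_zero_iff_left (sub_ne_zero.2 hw) |>.1 hl)
  rw [← sub_eq_zero.1 h1] at h2
  simp at h2

/-- The joint generalized eigenspaces of the centre of E are independent, span V and are permuted by
G. By primitivity one of them is all of V, so a central element has a single eigenvalue. -/
theorem eq_zero_or_one_of_isPrimitive [Finite G] [FiniteDimensional ℂ V] (hφ : IsProjective φ)
    (hs : IsSimple φ) (hp : IsPrimitive φ)
    (E : Subalgebra ℂ (Module.End ℂ V)) (c : G → E ≃ₐ[ℂ] E)
    (hc : ∀ g (X : E), (c g X : Module.End ℂ V) * (φ g).val = (φ g).val * X)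
    {z : E} (hz : ∀ X, z * X = X * z) (hzz : z * z = z) : z = 0 ∨ z = 1 := by
  have := hs.1
  let C := {z : E // ∀ X, z * X = X * z}
  let f : C → Module.End ℂ V := fun z => z.1
  have hcomm : ∀ i j, Commute (f i) (f j) := fun i j => congrArg Subtype.val (i.2 j.1)
  let W : (C → ℂ) → Submodule ℂ V := fun χ => ⨅ i, (f i).maxGenEigenspace (χ i)
  have hmem : ∀ χ v, v ∈ W χ ↔ ∀ i, ∃ k : ℕ, ((f i - χ i • 1) ^ k) v = 0 :=
    fun χ v => Module.End.mem_iInf_maxGenEigenspace_iff f χ v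
  have hind : iSupIndep W := Module.End.independent_iInf_maxGenEigenspace_of_forall_mapsTo f
    fun i j μ => Module.End.mapsTo_maxGenEigenspace_of_comm (hcomm j i) μ
  have hsup : ⨆ χ, W χ = ⊤ :=
    Module.End.iSup_iInf_maxGenEigenspace_eq_top_of_iSup_maxGenEigenspace_eq_top_of_commute f
      (fun i j _ => hcomm i j) fun i => Module.End.iSup_maxGenEigenspace_eq_top _
  have hperm : ∀ g χ, ∃ η, (W χ).map (φ g : V →ₗ[ℂ] V) = W η := by
    intro g χ
    have hcen : ∀ i : C, ∀ X, (c g).symm i.1 * X = X * (c g).symm i.1 := fun i X => by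
      apply (c g).injective
      rw [map_mul, map_mul, AlgEquiv.apply_symm_apply, i.2]
    have hcen' : ∀ i : C, ∀ X, c g i.1 * X = X * c g i.1 := fun i X => by
      apply (c g).symm.injective
      rw [map_mul, map_mul, AlgEquiv.symm_apply_apply, i.2]
    -- The operator φ(g) carries the eigenspace of χ to that of χ composed with the inverse of
    -- conjugation by g.
    let η : C → ℂ := fun i => χ ⟨(c g).symm i.1, hcen i⟩
    have hsemi : ∀ (X : E) (μ : ℂ) (k : ℕ) (v : V),
        (((c g X : Module.End ℂ V) - μ • 1) ^ k) ((φ g).val v) =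
          (φ g).val ((((X : Module.End ℂ V) - μ • 1) ^ k) v) := by
      intro X μ k v
      have h1 : SemiconjBy (φ g).val ((X : Module.End ℂ V) - μ • 1)
          ((c g X : Module.End ℂ V) - μ • 1) := by
        rw [SemiconjBy, mul_sub, sub_mul, hc, mul_smul_comm, smul_mul_assoc, mul_one, one_mul]
      exact (LinearMap.congr_fun (h1.pow_right k) v).symm
    refine ⟨η, le_antisymm ?_ ?_⟩
    · rintro _ ⟨v, hv, rfl⟩
      rw [hmem]
      intro i
      obtain ⟨k, hk⟩ := (hmem χ v).1 hv ⟨(c g).symm i.1, hcen i⟩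
      refine ⟨k, ?_⟩
      have h1 := hsemi ((c g).symm i.1) (η i) k v
      rw [AlgEquiv.apply_symm_apply] at h1
      exact h1.trans ((congrArg _ hk).trans (map_zero _))
    · intro w hw
      have hinv : (φ g).val (((φ g)⁻¹ : LinearMap.GeneralLinearGroup ℂ V).val w) = w :=
        LinearMap.congr_fun (φ g).mul_inv w
      refine ⟨((φ g)⁻¹ : LinearMap.GeneralLinearGroup ℂ V).val w, (hmem χ _).2 fun i => ?_, hinv⟩
      obtain ⟨k, hk⟩ := (hmem η w).1 hw ⟨c g i.1, hcen' i⟩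
      refine ⟨k, ?_⟩
      have h1 := hsemi i.1 (χ i) k (((φ g)⁻¹ : LinearMap.GeneralLinearGroup ℂ V).val w)
      have h2 : η ⟨c g i.1, hcen' i⟩ = χ i :=
        congrArg χ (Subtype.ext ((c g).symm_apply_apply i.1))
      rw [h2] at hk
      rw [hinv] at h1
      have h3 := h1.symm.trans hk
      have h4 := congrArg ((φ g)⁻¹ : LinearMap.GeneralLinearGroup ℂ V).val h3
      rw [map_zero] at h4
      exact (LinearMap.congr_fun (φ g).inv_mul _).symm.trans h4
  obtain ⟨χ, hχ⟩ : ∃ χ, W χ ≠ ⊥ := by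
    by_contra! h
    rw [iSup_eq_bot.2 h] at hsup
    exact bot_ne_top hsup
  have htop := hφ.eq_top_of_iSupIndep hs hp W hind hperm χ hχ
  have h1 : ∀ v, ∃ k : ℕ, (((z : Module.End ℂ V) - χ ⟨z, hz⟩ • 1) ^ k) v = 0 := fun v =>
    (hmem χ v).1 (htop ▸ Submodule.mem_top) ⟨z, hz⟩
  exact (eq_zero_or_one_of_isIdempotentElem (congrArg Subtype.val hzz) h1).imp
    Subtype.ext Subtype.ext

/-- By Wedderburn, E is a product of matrix algebras; the unit of one factor is a central
idempotent, so there is only one factor. -/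
theorem exists_algEquiv_matrix_of_isPrimitive [Finite G] [FiniteDimensional ℂ V]
    (hφ : IsProjective φ) (hs : IsSimple φ) (hp : IsPrimitive φ)
    (E : Subalgebra ℂ (Module.End ℂ V)) (c : G → E ≃ₐ[ℂ] E)
    (hc : ∀ g (X : E), (c g X : Module.End ℂ V) * (φ g).val = (φ g).val * X) :
    ∃ (d : ℕ) (_ : NeZero d), Nonempty (E ≃ₐ[ℂ] Matrix (Fin d) (Fin d) ℂ) := by
  have := hs.1
  have := isSemisimpleRing_of_isSimple hs E c hc
  obtain ⟨n, d, hd, ⟨e⟩⟩ := IsSemisimpleRing.exists_algEquiv_pi_matrix_of_isAlgClosed ℂ E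
  have hn : n ≠ 0 := by
    rintro rfl
    exact one_ne_zero (e.injective (Subsingleton.elim (e 1) (e 0)))
  let i : Fin n := ⟨0, Nat.pos_of_ne_zero hn⟩
  have hi : ∀ j, j = i := by
    by_contra! h
    obtain ⟨j, hj⟩ := h
    rcases eq_zero_or_one_of_isPrimitive hφ hs hp E c hc (z := e.symm (Pi.single i 1))
      (fun X => by
        apply e.injective
        rw [map_mul, map_mul, AlgEquiv.apply_symm_apply]
        funext k
        by_cases hk : k = i
        · subst hk; simp
        · simp [hk])
      (by rw [← map_mul, ← Pi.single_mul, mul_one]) with h | h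
    · have h1 := congrFun (congrArg e h) i
      rw [AlgEquiv.apply_symm_apply, Pi.single_eq_same, map_zero] at h1
      exact one_ne_zero h1
    · have h1 := congrFun (congrArg e h) j
      rw [AlgEquiv.apply_symm_apply, Pi.single_eq_of_ne hj, map_one] at h1
      exact zero_ne_one h1
  refine ⟨d i, hd i, ⟨e.trans (AlgEquiv.ofBijective (Pi.evalAlgHom ℂ _ i) ⟨?_, ?_⟩)⟩⟩
  · intro a b hab
    funext j
    obtain rfl := hi j
    exact hab
  · intro a
    refine ⟨fun j => if h : j = i then h ▸ a else 0, ?_⟩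
    simp

end ProjectiveMaps

/-! ### Pure tensors of operators and modules over a matrix algebra. -/

section TensorScalars

variable {Θ W : Type*} [AddCommGroup Θ] [Module ℂ Θ] [AddCommGroup W] [Module ℂ W]

/-- Contraction of the first tensor factor with a linear form. -/
def tensorEvalLeft (W : Type*) [AddCommGroup W] [Module ℂ W] (f : Θ →ₗ[ℂ] ℂ) : Θ ⊗[ℂ] W →ₗ[ℂ] W :=
  (TensorProduct.lid ℂ W).toLinearMap ∘ₗ TensorProduct.map f LinearMap.id

/-- Contraction of the second tensor factor with a linear form. -/
def tensorEvalRight (Θ : Type*) [AddCommGroup Θ] [Module ℂ Θ] (f : W →ₗ[ℂ] ℂ) : Θ ⊗[ℂ] W →ₗ[ℂ] Θ :=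
  (TensorProduct.rid ℂ Θ).toLinearMap ∘ₗ TensorProduct.map LinearMap.id f

@[simp]
lemma tensorEvalLeft_tmul (f : Θ →ₗ[ℂ] ℂ) (t : Θ) (w : W) :
    tensorEvalLeft W f (t ⊗ₜ w) = f t • w := by simp [tensorEvalLeft]

@[simp]
lemma tensorEvalRight_tmul (f : W →ₗ[ℂ] ℂ) (t : Θ) (w : W) :
    tensorEvalRight Θ f (t ⊗ₜ w) = f w • t := by simp [tensorEvalRight]

lemma eq_smul_one_of_map_eq_map [Nontrivial Θ] [Nontrivial W] {A : Module.End ℂ Θ}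
    {B : Module.End ℂ W} (h : TensorProduct.map A 1 = TensorProduct.map 1 B) :
    ∃ c : ℂ, A = c • 1 ∧ B = c • 1 := by
  obtain ⟨t, f, hf⟩ := exists_dual_apply_eq_one (V := Θ)
  obtain ⟨w, k, hk⟩ := exists_dual_apply_eq_one (V := W)
  have hB : B = f (A t) • 1 := LinearMap.ext fun x => by
    have h1 := congrArg (tensorEvalLeft W f) (LinearMap.congr_fun h (t ⊗ₜ x))
    simpa [hf] using h1.symm
  refine ⟨f (A t), LinearMap.ext fun x => ?_, hB⟩
  have h1 := congrArg (tensorEvalRight Θ k) (LinearMap.congr_fun h (x ⊗ₜ w))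
  rw [hB] at h1
  simpa [hk] using h1

lemma exists_smul_of_map_eq_map [Nontrivial Θ] [Nontrivial W] {X : Module.End ℂ Θ}
    {T : LinearMap.GeneralLinearGroup ℂ Θ} {S : LinearMap.GeneralLinearGroup ℂ W}
    (h : TensorProduct.map X (1 : Module.End ℂ W) = TensorProduct.map T.val S.val) :
    ∃ c : ℂˣ, X = (c : ℂ) • T.val ∧ S = c • 1 := by
  have h1 : TensorProduct.map (T⁻¹.val * X) (1 : Module.End ℂ W) =
      TensorProduct.map (1 : Module.End ℂ Θ) S.val := by
    have h2 := congrArg (fun Y => TensorProduct.map T⁻¹.val (1 : Module.End ℂ W) * Y) h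
    rwa [← TensorProduct.map_mul, ← TensorProduct.map_mul, Units.inv_mul, one_mul, one_mul] at h2
  obtain ⟨c, hc1, hc2⟩ := eq_smul_one_of_map_eq_map h1
  have hc : c ≠ 0 := by
    rintro rfl
    rw [zero_smul] at hc2
    exact S.ne_zero hc2
  refine ⟨Units.mk0 c hc, ?_, Units.ext hc2⟩
  have h2 := congrArg (fun Y => T.val * Y) hc1
  rwa [← mul_assoc, Units.mul_inv, one_mul, mul_smul_comm, mul_one] at h2

/-- A nonzero pure tensor determines its factors up to scalars. Multiplying by 1 ⊗ S⁻¹ reduces this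
to the case of an identity second factor. -/
lemma exists_smul_and_smul_of_map_eq [Nontrivial Θ] [Nontrivial W]
    {T T' : LinearMap.GeneralLinearGroup ℂ Θ} {S S' : LinearMap.GeneralLinearGroup ℂ W} {a : ℂˣ}
    (h : TensorProduct.map T.val S.val = (a : ℂ) • TensorProduct.map T'.val S'.val) :
    (∃ c : ℂˣ, T = c • T') ∧ ∃ c : ℂˣ, S = c • S' := by
  have h1 : TensorProduct.map T.val (1 : Module.End ℂ W) =
      TensorProduct.map T'.val (a • (S' * S⁻¹)).val := by
    have h2 := congrArg (fun Y => Y * TensorProduct.map (1 : Module.End ℂ Θ) S⁻¹.val) h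
    rw [smul_mul_assoc, ← TensorProduct.map_mul, ← TensorProduct.map_mul, Units.mul_inv, mul_one,
      mul_one] at h2
    rw [h2, GL.coe_smul, TensorProduct.map_smul_right, Units.val_mul]
  obtain ⟨c, hc1, hc2⟩ := exists_smul_of_map_eq_map h1
  refine ⟨⟨c, Units.ext hc1⟩, c⁻¹ * a, ?_⟩
  rw [mul_smul, inv_smul_eq_iff.2]
  have h3 := congrArg (· * S) hc2
  rw [smul_mul_assoc, smul_mul_assoc, inv_mul_cancel_right, one_mul] at h3
  exact h3

/-- With f(t) = 1, `B` is w ↦ (f ⊗ 1)D(t ⊗ w). Commuting D with the rank-one operator that sends t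
to x computes D(x ⊗ w). -/
lemma exists_eq_map_one_of_commute [Nontrivial Θ] {D : Module.End ℂ (Θ ⊗[ℂ] W)}
    (h : ∀ X : Module.End ℂ Θ, D * TensorProduct.map X 1 = TensorProduct.map X 1 * D) :
    ∃ B : Module.End ℂ W, D = TensorProduct.map 1 B := by
  obtain ⟨t, f, hf⟩ := exists_dual_apply_eq_one (V := Θ)
  refine ⟨tensorEvalLeft W f ∘ₗ D ∘ₗ TensorProduct.mk ℂ Θ W t, ?_⟩
  have key : ∀ (x : Θ) (y : Θ ⊗[ℂ] W),
      TensorProduct.map (f.smulRight x) (1 : Module.End ℂ W) y = x ⊗ₜ tensorEvalLeft W f y := by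
    intro x y
    induction y with
    | zero => simp
    | add a b ha hb => rw [map_add, map_add, ha, hb, TensorProduct.tmul_add]
    | tmul a b => simp [TensorProduct.smul_tmul]
  refine TensorProduct.ext' fun x w => ?_
  have h1 := LinearMap.congr_fun (h (f.smulRight x)) (t ⊗ₜ w)
  rw [Module.End.mul_apply, Module.End.mul_apply, key, key, tensorEvalLeft_tmul, hf, one_smul] at h1
  simpa using h1

variable {V : Type*} [AddCommGroup V] [Module ℂ V]

/-- A module over the algebra `End Θ` is a tensor product of `Θ` and a multiplicity space. -/
theorem exists_equiv_tensor_of_algHom [FiniteDimensional ℂ Θ] [Nontrivial Θ]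
    (F : Module.End ℂ Θ →ₐ[ℂ] Module.End ℂ V) :
    ∃ (W : Submodule ℂ V) (e : V ≃ₗ[ℂ] Θ ⊗[ℂ] W), ∀ (X : Module.End ℂ Θ) (v : V),
      e (F X v) = TensorProduct.map X 1 (e v) := by
  obtain ⟨t, f, hf⟩ := exists_dual_apply_eq_one (V := Θ)
  have hmul : ∀ (g h : Θ →ₗ[ℂ] ℂ) (x y : Θ) (v : V),
      F (g.smulRight x) (F (h.smulRight y) v) = g y • F (h.smulRight x) v := by
    intro g h x y v
    rw [← Module.End.mul_apply, ← map_mul, ← LinearMap.smul_apply, ← map_smul]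
    congr 2
    ext z
    simp [smul_smul, mul_comm]
  -- The image of a rank-one idempotent; its range is the multiplicity space. The maps `toV` and
  -- `ofV` below are the mutually inverse Morita maps, written with rank-one operators.
  let p : Module.End ℂ V := F (f.smulRight t)
  let W : Submodule ℂ V := LinearMap.range p
  have hpW : ∀ w : W, p w = w := by
    rintro ⟨_, v, rfl⟩
    show F (f.smulRight t) (F (f.smulRight t) v) = F (f.smulRight t) v
    rw [hmul, hf, one_smul]
  let b := Module.finBasis ℂ Θ
  have hrange : ∀ (h : Θ →ₗ[ℂ] ℂ) (v : V), F (h.smulRight t) v ∈ W := by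
    intro h v
    refine ⟨F (h.smulRight t) v, ?_⟩
    show F (f.smulRight t) (F (h.smulRight t) v) = F (h.smulRight t) v
    rw [hmul, hf, one_smul]
  let toV : Θ ⊗[ℂ] W →ₗ[ℂ] V := TensorProduct.lift
    (LinearMap.mk₂ ℂ (fun (x : Θ) (w : W) => F (f.smulRight x) w)
      (fun x y w => by
        rw [← LinearMap.add_apply, ← map_add]
        congr 2
        ext
        simp)
      (fun c x w => by
        rw [← LinearMap.smul_apply, ← map_smul]
        congr 2
        ext
        simp [smul_smul, mul_comm])
      (fun x w w' => by simp) (fun c x w => by simp))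
  have htoV : ∀ x w, toV (x ⊗ₜ w) = F (f.smulRight x) w := fun _ _ => rfl
  let ofV : V →ₗ[ℂ] Θ ⊗[ℂ] W := ∑ i, (TensorProduct.mk ℂ Θ W (b i)) ∘ₗ
    (F ((b.coord i).smulRight t)).codRestrict W (hrange _)
  have hofV : ∀ v, ofV v = ∑ i, b i ⊗ₜ (⟨F ((b.coord i).smulRight t) v, hrange _ v⟩ : W) := by
    intro v
    simp only [ofV, LinearMap.sum_apply]
    rfl
  have h1 : ∀ v, toV (ofV v) = v := by
    intro v
    rw [hofV, map_sum]
    simp only [htoV, hmul, hf, one_smul]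
    rw [← LinearMap.sum_apply, ← map_sum]
    have : ∑ i, (b.coord i).smulRight (b i) = (1 : Module.End ℂ Θ) := by
      ext x
      simp [b.sum_repr]
    rw [this, map_one, Module.End.one_apply]
  have h2 : ∀ s, ofV (toV s) = s := by
    intro s
    induction s with
    | zero => simp
    | add x y hx hy => rw [map_add, map_add, hx, hy]
    | tmul x w =>
      rw [htoV, hofV]
      have h3 : ∀ i, (⟨F ((b.coord i).smulRight t) (F (f.smulRight x) w), hrange _ _⟩ : W) =
          b.coord i x • w := fun i => Subtype.ext ((hmul _ _ _ _ _).trans (by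
            rw [show F (f.smulRight t) w = w from hpW w]; rfl))
      simp only [h3, ← TensorProduct.smul_tmul]
      rw [← TensorProduct.sum_tmul]
      congr 1
      simp [b.sum_repr]
  refine ⟨W, LinearEquiv.ofLinearMap ofV toV (LinearMap.ext h2) (LinearMap.ext h1), fun X v => ?_⟩
  show ofV (F X v) = TensorProduct.map X 1 (ofV v)
  have h3 : ∀ s, toV (TensorProduct.map X 1 s) = F X (toV s) := by
    intro s
    induction s with
    | zero => simp
    | add x y hx hy => simp only [map_add, hx, hy]
    | tmul x w =>
      rw [TensorProduct.map_tmul, htoV, htoV, ← Module.End.mul_apply, ← map_mul]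
      congr 2
      ext
      simp
  conv_lhs => rw [← h1 v, ← h3, h2]

end TensorScalars

/-! ### Tensor factorizations and Clifford theory. -/

section ProjectiveMaps

variable {G : Type*} [Group G]

section TensorFactors

variable {V Θ W : Type*} [AddCommGroup V] [Module ℂ V]
  [AddCommGroup Θ] [Module ℂ Θ] [AddCommGroup W] [Module ℂ W]

/-- `e` identifies `φ` with the tensor product of `T` and `S`, up to scalars. -/
def IsTensorEquiv (φ : G → LinearMap.GeneralLinearGroup ℂ V)
    (T : G → LinearMap.GeneralLinearGroup ℂ Θ) (S : G → LinearMap.GeneralLinearGroup ℂ W)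
    (e : V ≃ₗ[ℂ] Θ ⊗[ℂ] W) : Prop :=
  ∀ g, ∃ c : ℂˣ, ∀ v, e ((φ g : V →ₗ[ℂ] V) v) =
    (c : ℂ) • TensorProduct.map (T g : Θ →ₗ[ℂ] Θ) (S g : W →ₗ[ℂ] W) (e v)

variable {φ : G → LinearMap.GeneralLinearGroup ℂ V} {T : G → LinearMap.GeneralLinearGroup ℂ Θ}
  {S : G → LinearMap.GeneralLinearGroup ℂ W} {e : V ≃ₗ[ℂ] Θ ⊗[ℂ] W}

/-- The subspace of `V` corresponding to `Θ ⊗ U`. -/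
def tensorSubspace (e : V ≃ₗ[ℂ] Θ ⊗[ℂ] W) (U : Submodule ℂ W) : Submodule ℂ V :=
  LinearMap.range (e.symm.toLinearMap ∘ₗ U.subtype.lTensor Θ)

lemma finrank_tensorSubspace (e : V ≃ₗ[ℂ] Θ ⊗[ℂ] W) (U : Submodule ℂ W) :
    Module.finrank ℂ (tensorSubspace e U) = Module.finrank ℂ Θ * Module.finrank ℂ U := by
  rw [tensorSubspace, LinearMap.finrank_range_of_inj, Module.finrank_tensorProduct]
  exact e.symm.injective.comp
    (Module.Flat.lTensor_preserves_injective_linearMap _ U.injective_subtype)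

lemma IsStable.tensorSubspace (he : IsTensorEquiv φ T S e) {J : Subgroup G} {U : Submodule ℂ W}
    (hU : IsStable S J U) : IsStable φ J (tensorSubspace e U) := by
  rintro g hg _ ⟨t, rfl⟩
  obtain ⟨c, hc⟩ := he g
  refine ⟨(c : ℂ) • TensorProduct.map (T g : Θ →ₗ[ℂ] Θ)
    ((S g : W →ₗ[ℂ] W).restrict (hU g hg)) t, e.injective ?_⟩
  rw [hc, map_smul, map_smul]
  congr 1
  simp only [LinearMap.comp_apply, LinearEquiv.coe_coe, LinearEquiv.apply_symm_apply]
  induction t with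
  | zero => simp
  | add x y hx hy => simp only [map_add, hx, hy]
  | tmul x y => simp

/-- U ↦ Θ ⊗ U sends stable subspaces of W to stable subspaces of V and multiplies dimensions by dim
Θ. Primitivity passes to `S` for the same reason. -/
lemma IsTensorEquiv.isSimple_right [FiniteDimensional ℂ V] [FiniteDimensional ℂ W]
    [FiniteDimensional ℂ Θ] [Nontrivial Θ]
    (he : IsTensorEquiv φ T S e) (hs : IsSimple φ) : IsSimple S := by
  have := hs.1
  have hdim : Module.finrank ℂ V = Module.finrank ℂ Θ * Module.finrank ℂ W := by
    rw [e.finrank_eq, Module.finrank_tensorProduct]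
  have hV := Module.finrank_pos (R := ℂ) (M := V)
  have hΘ := Module.finrank_pos (R := ℂ) (M := Θ)
  refine ⟨Module.nontrivial_of_finrank_pos (R := ℂ)
    (Nat.pos_of_ne_zero fun h => by rw [h, mul_zero] at hdim; omega), fun U hU => ?_⟩
  have h1 := finrank_tensorSubspace e U
  rcases hs.2 _ (hU.tensorSubspace he) with h | h
  · left
    rw [h, finrank_bot, eq_comm, mul_eq_zero] at h1
    exact Submodule.finrank_eq_zero.1 (h1.resolve_left hΘ.ne')
  · right
    rw [h, finrank_top, hdim] at h1
    exact Submodule.eq_top_of_finrank_eq (Nat.eq_of_mul_eq_mul_left hΘ h1).symm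

lemma IsTensorEquiv.isPrimitive_right [FiniteDimensional ℂ W]
    [FiniteDimensional ℂ Θ] [Nontrivial Θ]
    (he : IsTensorEquiv φ T S e) (hp : IsPrimitive φ) : IsPrimitive S := by
  intro J U hU0 hU hd
  have h1 := finrank_tensorSubspace e U
  refine hp J (tensorSubspace e U) (fun h => hU0 ?_) (hU.tensorSubspace he) ?_
  · rw [h, finrank_bot, eq_comm, mul_eq_zero] at h1
    exact Submodule.finrank_eq_zero.1
      (h1.resolve_left (Module.finrank_pos (R := ℂ) (M := Θ)).ne')
  · rw [e.finrank_eq, Module.finrank_tensorProduct, h1, hd]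
    ring

lemma IsTensorEquiv.isProjective [Nontrivial Θ] [Nontrivial W] (he : IsTensorEquiv φ T S e)
    (hφ : IsProjective φ) : IsProjective T ∧ IsProjective S := by
  have key : ∀ g h, ∃ a : ℂˣ, TensorProduct.map (T g * T h).val (S g * S h).val =
      (a : ℂ) • TensorProduct.map (T (g * h)).val (S (g * h)).val := by
    intro g h
    obtain ⟨a, ha⟩ := he g
    obtain ⟨b, hb⟩ := he h
    obtain ⟨c, hc⟩ := he (g * h)
    obtain ⟨m, hm⟩ := hφ g h
    refine ⟨(a * b)⁻¹ * (m * c), LinearMap.ext fun t => ?_⟩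
    obtain ⟨v, rfl⟩ := e.surjective t
    have h1 : e ((φ g).val ((φ h).val v)) = e ((m : ℂ) • (φ (g * h)).val v) :=
      congrArg (fun u : LinearMap.GeneralLinearGroup ℂ V => e (u.val v)) hm
    rw [ha, hb, map_smul, map_smul e, hc, smul_smul, smul_smul, ← Module.End.mul_apply,
      ← TensorProduct.map_mul, ← Units.val_mul, ← Units.val_mul, ← Units.val_mul,
      ← Units.val_mul, ← Units.smul_def, ← Units.smul_def] at h1
    rw [LinearMap.smul_apply, ← Units.smul_def, mul_smul, ← h1, inv_smul_smul]
  constructor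
  · intro g h
    obtain ⟨a, ha⟩ := key g h
    exact (exists_smul_and_smul_of_map_eq ha).1
  · intro g h
    obtain ⟨a, ha⟩ := key g h
    exact (exists_smul_and_smul_of_map_eq ha).2

end TensorFactors

section Clifford

variable {V : Type v} [AddCommGroup V] [Module ℂ V]
  {φ : G → LinearMap.GeneralLinearGroup ℂ V}

omit [Group G] in
/-- The operators normalizing a full matrix subalgebra are pure tensors. -/
theorem exists_tensor_of_algEquiv {Θ : Type v} [AddCommGroup Θ] [Module ℂ Θ]
    [FiniteDimensional ℂ Θ] [Nontrivial Θ] [FiniteDimensional ℂ V] [Nontrivial V]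
    (E : Subalgebra ℂ (Module.End ℂ V)) (c : G → E ≃ₐ[ℂ] E)
    (hc : ∀ g (X : E), (c g X : Module.End ℂ V) * (φ g).val = (φ g).val * X)
    (F : Module.End ℂ Θ ≃ₐ[ℂ] E) :
    ∃ (W : Submodule ℂ V) (e : V ≃ₗ[ℂ] Θ ⊗[ℂ] W) (T : G → LinearMap.GeneralLinearGroup ℂ Θ)
      (S : G → LinearMap.GeneralLinearGroup ℂ W), IsTensorEquiv φ T S e ∧
      ∀ k (X : E), (φ k).val = X → Nontrivial W → ∃ a : ℂˣ,
        F.symm X = (a : ℂ) • (T k).val ∧ S k = a • 1 := by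
  obtain ⟨W, e, he⟩ := exists_equiv_tensor_of_algHom (E.val.comp F.toAlgHom)
  have he' : ∀ X v, e ((F X : Module.End ℂ V) v) = TensorProduct.map X 1 (e v) := he
  have key : ∀ g, ∃ (T : LinearMap.GeneralLinearGroup ℂ Θ) (S : LinearMap.GeneralLinearGroup ℂ W),
      ∀ v, e ((φ g).val v) = TensorProduct.map T.val S.val (e v) := by
    intro g
    -- Skolem–Noether: conjugation by φ(g), transported to End Θ, is conjugation by some T.
    obtain ⟨t, ht⟩ := ((F.trans (c g)).trans F.symm).eq_linearEquivConjAlgEquiv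
    let T : LinearMap.GeneralLinearGroup ℂ Θ :=
      (LinearMap.GeneralLinearGroup.generalLinearEquiv ℂ Θ).symm t
    have hT : ∀ X, c g (F X) = F (T.val * X * T⁻¹.val) := by
      intro X
      have h1 := AlgEquiv.congr_fun ht X
      rw [AlgEquiv.trans_apply, AlgEquiv.trans_apply, AlgEquiv.symm_apply_eq] at h1
      exact h1
    let Φ : Module.End ℂ (Θ ⊗[ℂ] W) := e.toLinearMap ∘ₗ (φ g).val ∘ₗ e.symm.toLinearMap
    have hΦ : ∀ v, Φ (e v) = e ((φ g).val v) := fun v => by simp [Φ]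
    have hcomm : ∀ X, Φ * TensorProduct.map X 1 = TensorProduct.map (T.val * X * T⁻¹.val) 1 * Φ := by
      intro X
      refine LinearMap.ext fun s => ?_
      obtain ⟨v, rfl⟩ := e.surjective s
      rw [Module.End.mul_apply, Module.End.mul_apply, ← he', hΦ, hΦ, ← he', ← hT]
      exact congrArg e (LinearMap.congr_fun (hc g (F X)) v).symm
    -- After T is divided out, φ(g) commutes with End Θ ⊗ 1 and so acts on the multiplicity space
    -- only.
    obtain ⟨B, hB⟩ := exists_eq_map_one_of_commute
      (D := TensorProduct.map T⁻¹.val (1 : Module.End ℂ W) * Φ) (fun X => by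
        rw [mul_assoc, hcomm, ← mul_assoc, ← mul_assoc, ← TensorProduct.map_mul,
          ← TensorProduct.map_mul, ← mul_assoc, ← mul_assoc, Units.inv_mul, one_mul])
    have hΦB : Φ = TensorProduct.map T.val B := by
      have h1 := congrArg (fun Y => TensorProduct.map T.val (1 : Module.End ℂ W) * Y) hB
      rwa [← mul_assoc, ← TensorProduct.map_mul, ← TensorProduct.map_mul, Units.mul_inv, one_mul,
        one_mul, mul_one, TensorProduct.map_one, one_mul] at h1
    obtain ⟨t0, f, hf⟩ := exists_dual_apply_eq_one (V := Θ)
    have hker : LinearMap.ker B = ⊥ := by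
      rw [LinearMap.ker_eq_bot']
      intro w hw
      have h1 : Φ (t0 ⊗ₜ w) = 0 := by
        rw [hΦB, TensorProduct.map_tmul, hw, TensorProduct.tmul_zero]
      obtain ⟨v, hv⟩ := e.surjective (t0 ⊗ₜ w)
      rw [← hv, hΦ, LinearEquiv.map_eq_zero_iff] at h1
      have h2 : v = 0 := by
        have h3 := congrArg (φ g)⁻¹.val h1
        rw [map_zero] at h3
        exact (LinearMap.congr_fun (φ g).inv_mul v).symm.trans h3
      rw [h2, map_zero] at hv
      have h3 := congrArg (tensorEvalLeft W f) hv
      rw [map_zero, tensorEvalLeft_tmul, hf, one_smul] at h3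
      exact h3.symm
    refine ⟨T, ((LinearMap.isUnit_iff_ker_eq_bot B).2 hker).unit, fun v => ?_⟩
    rw [IsUnit.unit_spec, ← hΦ, hΦB]
  choose T S hTS using key
  refine ⟨W, e, T, S, fun g => ⟨1, fun v => by rw [hTS, Units.val_one, one_smul]⟩, ?_⟩
  intro k X hX hW
  refine exists_smul_of_map_eq_map (LinearMap.ext fun s => ?_)
  obtain ⟨v, rfl⟩ := e.surjective s
  rw [← hTS, ← he', AlgEquiv.apply_symm_apply, hX]

/-- Clifford theory: a primitive representation is the tensor product of a representation whose
restriction to the normal subgroup `K` is absolutely irreducible and of one on which `K` acts by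
scalars. -/
theorem exists_tensor_of_isPrimitive [Finite G] [FiniteDimensional ℂ V] (hφ : IsProjective φ)
    (hs : IsSimple φ) (hp : IsPrimitive φ) (K : Subgroup G) [K.Normal] :
    ∃ (Θ : Type v) (_ : AddCommGroup Θ) (_ : Module ℂ Θ) (_ : FiniteDimensional ℂ Θ)
      (_ : Nontrivial Θ) (W : Submodule ℂ V) (e : V ≃ₗ[ℂ] Θ ⊗[ℂ] W)
      (T : G → LinearMap.GeneralLinearGroup ℂ Θ) (S : G → LinearMap.GeneralLinearGroup ℂ W),
      IsTensorEquiv φ T S e ∧ IsProjective T ∧ IsProjective S ∧ IsSimple S ∧ IsPrimitive S ∧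
      Submodule.span ℂ (Set.range fun k : K => (T k : Module.End ℂ Θ)) = ⊤ ∧
      (∀ k ∈ K, ∃ a : ℂˣ, S k = a • 1) ∧
      (∀ k ∈ K, (∃ a : ℂˣ, φ k = a • 1) → ∃ a : ℂˣ, T k = a • 1) := by
  have := hs.1
  have hc := hφ.conjAlgEquiv_mul K
  have hmem : ∀ k ∈ K, (φ k).val ∈ hφ.spanAlgebra K := fun k hk => hφ.mem_spanAlgebra hk
  have hspan : ∀ X ∈ hφ.spanAlgebra K,
      X ∈ Submodule.span ℂ (Set.range fun k : K => (φ k : Module.End ℂ V)) := fun X hX => hX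
  generalize hφ.conjAlgEquiv K = c at hc
  generalize hφ.spanAlgebra K = E at c hc hmem hspan
  obtain ⟨d, hd, ⟨m⟩⟩ := exists_algEquiv_matrix_of_isPrimitive hφ hs hp E c hc
  -- The lift places all tensor factors in the universe of V, as the later induction requires.
  let Θ := ULift.{v} (Fin d → ℂ)
  have hΘ : Nontrivial Θ := ULift.nontrivial
  let F : Module.End ℂ Θ ≃ₐ[ℂ] E :=
    (((ULift.moduleEquiv : Θ ≃ₗ[ℂ] (Fin d → ℂ)).conjAlgEquiv ℂ).trans
      Matrix.toLinAlgEquiv'.symm).trans m.symm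
  obtain ⟨W, e, T, S, he, hk⟩ := exists_tensor_of_algEquiv E c hc F
  have hS := he.isSimple_right hs
  have hW := hS.1
  have hproj := he.isProjective hφ
  have hT : ∀ k ∈ K, ∃ a : ℂˣ, (φ k).val = (a : ℂ) • (F (T k).val : Module.End ℂ V) := by
    intro k hkK
    obtain ⟨a, ha, -⟩ := hk k ⟨_, hmem k hkK⟩ rfl hW
    refine ⟨a, ?_⟩
    rw [AlgEquiv.symm_apply_eq, map_smul] at ha
    exact congrArg Subtype.val ha
  refine ⟨Θ, _, _, inferInstance, hΘ, W, e, T, S, he, hproj.1, hproj.2, hS,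
    he.isPrimitive_right hp, ?_, ?_, ?_⟩
  · rw [eq_top_iff]
    rintro X -
    have h1 := hspan _ (F X).2
    have h2 : Submodule.span ℂ (Set.range fun k : K => (φ k : Module.End ℂ V)) ≤
        (Submodule.span ℂ (Set.range fun k : K => (T k : Module.End ℂ Θ))).map
          (E.val.toLinearMap ∘ₗ F.toLinearMap) := by
      rw [Submodule.span_le]
      rintro _ ⟨k, rfl⟩
      obtain ⟨a, ha⟩ := hT k k.2
      refine ⟨(a : ℂ) • (T k).val, Submodule.smul_mem _ _ (Submodule.subset_span ⟨k, rfl⟩), ?_⟩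
      rw [map_smul]
      exact ha.symm
    obtain ⟨Y, hY, hXY⟩ := h2 h1
    rwa [← F.injective (Subtype.ext hXY)]
  · intro k hkK
    obtain ⟨a, -, ha⟩ := hk k ⟨_, hmem k hkK⟩ rfl hW
    exact ⟨a, ha⟩
  · rintro k hkK ⟨b, hb⟩
    obtain ⟨a, ha⟩ := hT k hkK
    refine ⟨a⁻¹ * b, Units.ext (F.injective (Subtype.ext ?_))⟩
    have h1 : (F (T k).val : Module.End ℂ V) = (a⁻¹ : ℂˣ) • (φ k).val := by
      rw [ha, Units.smul_def, smul_smul, ← Units.val_mul, inv_mul_cancel, Units.val_one, one_smul]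
    rw [h1, hb, GL.coe_smul, GL.coe_smul, map_smul, Units.val_one, Units.val_one, map_one, Units.smul_def,
      smul_smul, Units.val_mul]
    rfl

end Clifford

end ProjectiveMaps

/-! ### Absolute irreducibility of tensor products. -/

section SpanTensor

variable {G : Type*} [Group G] {Θ A : Type*} [AddCommGroup Θ] [Module ℂ Θ]
  [AddCommGroup A] [Module ℂ A]

/-- The tensor product of two invertible operators. -/
def GL.tensor (u : LinearMap.GeneralLinearGroup ℂ Θ) (w : LinearMap.GeneralLinearGroup ℂ A) :
    LinearMap.GeneralLinearGroup ℂ (Θ ⊗[ℂ] A) where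
  val := TensorProduct.map u.val w.val
  inv := TensorProduct.map u⁻¹.val w⁻¹.val
  val_inv := by rw [← TensorProduct.map_mul, Units.mul_inv, Units.mul_inv, TensorProduct.map_one]
  inv_val := by rw [← TensorProduct.map_mul, Units.inv_mul, Units.inv_mul, TensorProduct.map_one]

variable {T : G → LinearMap.GeneralLinearGroup ℂ Θ} {a : G → LinearMap.GeneralLinearGroup ℂ A}

lemma IsProjective.tensor (hT : IsProjective T) (ha : IsProjective a) :
    IsProjective fun g => GL.tensor (T g) (a g) := by
  intro x y
  obtain ⟨b, hb⟩ := hT x y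
  obtain ⟨c, hc⟩ := ha x y
  refine ⟨b * c, Units.ext ?_⟩
  change TensorProduct.map (T x).val (a x).val * TensorProduct.map (T y).val (a y).val =
    ((b * c : ℂˣ) : ℂ) • TensorProduct.map (T (x * y)).val (a (x * y)).val
  rw [← TensorProduct.map_mul, ← Units.val_mul, ← Units.val_mul, hb, hc, GL.coe_smul, GL.coe_smul,
    TensorProduct.map_smul_left, TensorProduct.map_smul_right, smul_smul, Units.val_mul]

/-- On L the second factor is scalar, so the span contains End Θ ⊗ 1. Multiplying T(h) ⊗ a(h) by
T(h)⁻¹ ⊗ 1 then yields 1 ⊗ a(h), hence 1 ⊗ End A. -/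
theorem span_tensor_eq_top [FiniteDimensional ℂ Θ] [FiniteDimensional ℂ A]
    (hT : IsProjective T) (ha : IsProjective a) {L H : Subgroup G} (hLH : L ≤ H)
    (hTL : Submodule.span ℂ (Set.range fun l : L => (T l : Module.End ℂ Θ)) = ⊤)
    (haL : ∀ l ∈ L, ∃ c : ℂˣ, a l = c • 1)
    (haH : Submodule.span ℂ (Set.range fun h : H => (a h : Module.End ℂ A)) = ⊤) :
    Submodule.span ℂ (Set.range fun h : H =>
      (GL.tensor (T h) (a h) : Module.End ℂ (Θ ⊗[ℂ] A))) = ⊤ := by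
  let S := (hT.tensor ha).spanAlgebra H
  have h1 : ∀ X : Module.End ℂ Θ, TensorProduct.map X (1 : Module.End ℂ A) ∈ S := by
    intro X
    have hX : X ∈ Submodule.span ℂ (Set.range fun l : L => (T l : Module.End ℂ Θ)) :=
      hTL ▸ Submodule.mem_top
    induction hX using Submodule.span_induction with
    | mem x hx =>
      obtain ⟨l, rfl⟩ := hx
      obtain ⟨c, hc⟩ := haL l l.2
      have h2 := S.smul_mem ((hT.tensor ha).mem_spanAlgebra (hLH l.2)) ((c⁻¹ : ℂˣ) : ℂ)
      change ((c⁻¹ : ℂˣ) : ℂ) • TensorProduct.map _ _ ∈ S at h2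
      rwa [hc, GL.coe_smul, TensorProduct.map_smul_right, smul_smul, ← Units.val_mul,
        inv_mul_cancel, Units.val_one, one_smul] at h2
    | zero => rw [TensorProduct.map_zero_left]; exact zero_mem _
    | add x y _ _ hx hy => rw [TensorProduct.map_add_left]; exact add_mem hx hy
    | smul c x _ hx => rw [TensorProduct.map_smul_left]; exact S.smul_mem hx _
  have h2 : ∀ Y : Module.End ℂ A, TensorProduct.map (1 : Module.End ℂ Θ) Y ∈ S := by
    intro Y
    have hY : Y ∈ Submodule.span ℂ (Set.range fun h : H => (a h : Module.End ℂ A)) :=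
      haH ▸ Submodule.mem_top
    induction hY using Submodule.span_induction with
    | mem x hx =>
      obtain ⟨h, rfl⟩ := hx
      have h2 := S.mul_mem (h1 (T h)⁻¹.val) ((hT.tensor ha).mem_spanAlgebra h.2)
      change TensorProduct.map _ _ * TensorProduct.map _ _ ∈ S at h2
      rwa [← TensorProduct.map_mul, one_mul, Units.inv_mul] at h2
    | zero => rw [TensorProduct.map_zero_right]; exact zero_mem _
    | add x y _ _ hx hy => rw [TensorProduct.map_add_right]; exact add_mem hx hy
    | smul c x _ hx => rw [TensorProduct.map_smul_right]; exact S.smul_mem hx _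
  rw [eq_top_iff]
  rintro D -
  change D ∈ S
  obtain ⟨t, rfl⟩ := (homTensorHomEquiv ℂ Θ A Θ A).surjective D
  induction t with
  | zero => rw [map_zero]; exact zero_mem _
  | add x y hx hy => rw [map_add]; exact add_mem hx hy
  | tmul X Y =>
    rw [homTensorHomEquiv_apply, TensorProduct.homTensorHomMap_apply]
    have h3 := S.mul_mem (h1 X) (h2 Y)
    rwa [← TensorProduct.map_mul, mul_one, one_mul] at h3

/-- Each k in K is ln with l in H ∩ K and n in N, and T(n) is scalar, so T(k) is proportional to
T(l). -/
lemma IsProjective.span_inf_eq_top (hT : IsProjective T) {H N K : Subgroup G} [N.Normal]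
    (hK : K ≤ (H ⊓ K) ⊔ N)
    (hTK : Submodule.span ℂ (Set.range fun k : K => (T k : Module.End ℂ Θ)) = ⊤)
    (hN : ∀ n ∈ N, ∃ c : ℂˣ, T n = c • 1) :
    Submodule.span ℂ (Set.range fun l : (H ⊓ K : Subgroup G) => (T l : Module.End ℂ Θ)) = ⊤ := by
  rw [eq_top_iff, ← hTK, Submodule.span_le]
  rintro _ ⟨k, rfl⟩
  obtain ⟨l, hl, n, hn, hln⟩ := Subgroup.mem_sup_of_normal_right.1 (hK k.2)
  obtain ⟨c, hc⟩ := hN n hn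
  obtain ⟨b, hb⟩ := hT l n
  have h1 : T k = (b⁻¹ * c) • T l := by
    have h2 : c • T l = T l * T n := by rw [hc, mul_smul_comm, mul_one]
    rw [mul_smul, h2, hb, smul_smul, inv_mul_cancel, one_smul, hln]
  dsimp only
  rw [h1, GL.coe_smul]
  exact Submodule.smul_mem _ _ (Submodule.subset_span
    (⟨⟨l, hl⟩, rfl⟩ : _ ∈ Set.range fun l : (H ⊓ K : Subgroup G) => (T l : Module.End ℂ Θ)))

end SpanTensor

/-! ### Factorization of primitive representations along the series. -/

section Factorization

variable {G : Type*} [Group G] {π : Set Nat.Primes} {V : Type v} [AddCommGroup V] [Module ℂ V]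

/-- `φ` is, up to scalars, the tensor product of a projective representation whose degree is a
`π`-number and which is absolutely irreducible on Hall `π`-subgroups, and of a projective
representation with the same property for `π'`. -/
def HasFactorization (π : Set Nat.Primes) (φ : G → LinearMap.GeneralLinearGroup ℂ V) : Prop :=
  ∃ (A : Type v) (_ : AddCommGroup A) (_ : Module ℂ A) (_ : FiniteDimensional ℂ A)
    (B : Type v) (_ : AddCommGroup B) (_ : Module ℂ B) (_ : FiniteDimensional ℂ B)
    (a : G → LinearMap.GeneralLinearGroup ℂ A) (b : G → LinearMap.GeneralLinearGroup ℂ B)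
    (e : V ≃ₗ[ℂ] A ⊗[ℂ] B), IsTensorEquiv φ a b e ∧ IsProjective a ∧ IsProjective b ∧
    IsPiNumber π (Module.finrank ℂ A) ∧ IsPiNumber πᶜ (Module.finrank ℂ B) ∧
    (∀ H : Subgroup G, IsHallSubgroup π H →
      Submodule.span ℂ (Set.range fun h : H => (a h : Module.End ℂ A)) = ⊤) ∧
    (∀ H : Subgroup G, IsHallSubgroup πᶜ H →
      Submodule.span ℂ (Set.range fun h : H => (b h : Module.End ℂ B)) = ⊤)

variable {φ : G → LinearMap.GeneralLinearGroup ℂ V}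

lemma HasFactorization.compl (h : HasFactorization π φ) : HasFactorization πᶜ φ := by
  obtain ⟨A, _, _, _, B, _, _, _, a, b, e, he, ha, hb, hA, hB, hHa, hHb⟩ := h
  refine ⟨B, _, _, ‹_›, A, _, _, ‹_›, b, a, e.trans (TensorProduct.comm ℂ A B), ?_, hb, ha, hB,
    by rwa [compl_compl], hHb, by rwa [compl_compl]⟩
  intro g
  obtain ⟨c, hc⟩ := he g
  refine ⟨c, fun v => ?_⟩
  rw [LinearEquiv.trans_apply, LinearEquiv.trans_apply, hc, map_smul, TensorProduct.map_comm]

/-- Multiplying the first factor by a representation that is absolutely irreducible on a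
`π`-section. -/
theorem HasFactorization.tensor [Finite G] {Θ W : Type v} [AddCommGroup Θ] [Module ℂ Θ]
    [FiniteDimensional ℂ Θ] [Nontrivial Θ] [AddCommGroup W] [Module ℂ W]
    {T : G → LinearMap.GeneralLinearGroup ℂ Θ} {S : G → LinearMap.GeneralLinearGroup ℂ W}
    (hS : HasFactorization π S) {e : V ≃ₗ[ℂ] Θ ⊗[ℂ] W} (he : IsTensorEquiv φ T S e)
    (hT : IsProjective T) {N K : Subgroup G} [N.Normal] [K.Normal]
    (hNK : IsPiNumber π (N.relIndex K))
    (hTK : Submodule.span ℂ (Set.range fun k : K => (T k : Module.End ℂ Θ)) = ⊤)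
    (hTN : ∀ n ∈ N, ∃ c : ℂˣ, T n = c • 1) (hSK : ∀ k ∈ K, ∃ c : ℂˣ, S k = c • 1) :
    HasFactorization π φ := by
  obtain ⟨A, _, _, _, B, _, _, _, a, b, f, hf, ha, hb, hA, hB, hHa, hHb⟩ := hS
  have hAn : Nontrivial A := Module.nontrivial_of_finrank_pos (R := ℂ) (Nat.pos_of_ne_zero hA.1)
  have hBn : Nontrivial B := Module.nontrivial_of_finrank_pos (R := ℂ) (Nat.pos_of_ne_zero hB.1)
  -- On K the tensor product a ⊗ b is scalar, so its factors are scalar too.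
  have haK : ∀ k ∈ K, ∃ c : ℂˣ, a k = c • 1 := by
    intro k hk
    obtain ⟨c, hc⟩ := hSK k hk
    obtain ⟨d, hd⟩ := hf k
    refine (exists_smul_and_smul_of_map_eq (a := d⁻¹ * c) (S := b k) (S' := 1)
      (LinearMap.ext fun t => ?_)).1
    obtain ⟨w, rfl⟩ := f.surjective t
    have h1 := hd w
    rw [hc, GL.coe_smul, LinearMap.smul_apply, map_smul, ← Units.smul_def, ← Units.smul_def,
      ← inv_smul_eq_iff, smul_smul] at h1
    rw [← h1, Units.val_one, Units.val_one, Units.val_one, TensorProduct.map_one]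
    rfl
  have hdvd : Module.finrank ℂ Θ ∣ N.relIndex K := by
    refine finrank_dvd_index (hT.restrict K) hTK (N.subgroupOf K) fun n hn => hTN n hn
  let E : V ≃ₗ[ℂ] (Θ ⊗[ℂ] A) ⊗[ℂ] B := e.trans
    ((TensorProduct.congr (LinearEquiv.refl ℂ Θ) f).trans (TensorProduct.assoc ℂ Θ A B).symm)
  refine ⟨Θ ⊗[ℂ] A, _, _, inferInstance, B, _, _, ‹_›, fun g => GL.tensor (T g) (a g), b, E, ?_,
    hT.tensor ha, hb, ?_, hB, fun H hH => ?_, hHb⟩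
  · intro g
    obtain ⟨c, hc⟩ := he g
    obtain ⟨d, hd⟩ := hf g
    refine ⟨c * d, fun v => ?_⟩
    have key : ∀ t : Θ ⊗[ℂ] W, (TensorProduct.assoc ℂ Θ A B).symm
        (TensorProduct.congr (LinearEquiv.refl ℂ Θ) f
          (TensorProduct.map (T g).val (S g).val t)) =
        (d : ℂ) • TensorProduct.map (TensorProduct.map (T g).val (a g).val) (b g).val
          ((TensorProduct.assoc ℂ Θ A B).symm (TensorProduct.congr (LinearEquiv.refl ℂ Θ) f t)) := by
      intro t
      induction t with
      | zero => simp
      | add x y hx hy => simp only [map_add, hx, hy, smul_add]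
      | tmul x w =>
        rw [TensorProduct.map_tmul, TensorProduct.congr_tmul, TensorProduct.congr_tmul, hd]
        generalize f w = s
        induction s with
        | zero => simp
        | add x y hx hy => simp only [map_add, smul_add, TensorProduct.tmul_add, hx, hy]
        | tmul y z => simp [TensorProduct.tmul_smul]
    show (TensorProduct.assoc ℂ Θ A B).symm
        (TensorProduct.congr (LinearEquiv.refl ℂ Θ) f (e ((φ g).val v))) = _
    rw [hc, map_smul, map_smul, key, smul_smul, Units.val_mul]
    rfl
  · rw [Module.finrank_tensorProduct]
    exact (hNK.of_dvd hdvd).mul hA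
  · exact span_tensor_eq_top hT ha inf_le_left
      (hT.span_inf_eq_top (hH.le_inf_sup hNK) hTK hTN)
      (fun l hl => haK l (Subgroup.mem_inf.1 hl).2) (hHa H hH)

/-- Every line is stable, so V is a line; the second factor is the trivial one-dimensional
representation. -/
lemma hasFactorization_of_forall_scalar (π : Set Nat.Primes) [FiniteDimensional ℂ V]
    (hφ : IsProjective φ) (hs : IsSimple φ) (h : ∀ g, ∃ c : ℂˣ, φ g = c • 1) :
    HasFactorization π φ := by
  have := hs.1
  obtain ⟨v, hv⟩ := exists_ne (0 : V)
  have htop : Submodule.span ℂ {v} = ⊤ := by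
    refine (hs.2 _ fun g _ u hu => ?_).resolve_left (by simpa using hv)
    obtain ⟨c, hc⟩ := h g
    rw [hc]
    exact Submodule.smul_mem _ (c : ℂ) hu
  have hdim : Module.finrank ℂ V = 1 := (finrank_eq_one_iff_of_nonzero v hv).2 htop
  have hspan : ∀ (U : Type v) [AddCommGroup U] [Module ℂ U],
      Module.finrank ℂ U = 1 → ∀ (ψ : G → LinearMap.GeneralLinearGroup ℂ U) (H : Subgroup G),
        Submodule.span ℂ (Set.range fun h : H => (ψ h : Module.End ℂ U)) = ⊤ := by
    intro U _ _ hU ψ H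
    have : Nontrivial U := Module.nontrivial_of_finrank_pos (R := ℂ) (by omega)
    have : FiniteDimensional ℂ U := Module.finite_of_finrank_pos (by omega)
    have h1 : Module.finrank ℂ (Module.End ℂ U) = 1 := by
      exact (Module.finrank_linearMap ℂ ℂ U U).trans (by rw [hU])
    rw [eq_top_iff, ← (finrank_eq_one_iff_of_nonzero _ (ψ 1).ne_zero).1 h1]
    exact Submodule.span_mono (by rintro _ rfl; exact ⟨1, rfl⟩)
  have hdim' : Module.finrank ℂ (ULift.{v} ℂ) = 1 := by
    rw [(ULift.moduleEquiv : ULift.{v} ℂ ≃ₗ[ℂ] ℂ).finrank_eq, Module.finrank_self]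
  refine ⟨V, _, _, ‹_›, ULift.{v} ℂ, _, _, inferInstance, φ, 1,
    (TensorProduct.rid ℂ V).symm.trans (TensorProduct.congr (LinearEquiv.refl ℂ V)
      ULift.moduleEquiv.symm), fun g => ⟨1, fun w => ?_⟩, hφ, fun _ _ => ⟨1, by simp⟩,
    by rw [hdim]; exact isPiNumber_one _, by rw [hdim']; exact isPiNumber_one _,
    fun H _ => hspan V hdim φ H, fun H _ => hspan _ hdim' 1 H⟩
  simp

/-- Induction on the number k of factors above the term acting by scalars, over all representations
at once, because the hypothesis is applied to the multiplicity space. A π'-factor is handled by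
exchanging π and π'. -/
theorem hasFactorization_of_isPrimitive [Finite G] {l : ℕ} {N : ℕ → Subgroup G} (hl : N l = ⊤)
    (hN : ∀ i < l, (N i).Normal ∧ (N (i + 1)).Normal ∧
      (IsPiNumber π ((N i).relIndex (N (i + 1))) ∨ IsPiNumber πᶜ ((N i).relIndex (N (i + 1)))))
    (hle : ∀ i < l, N i ≤ N (i + 1)) {k : ℕ} (hk : k ≤ l) :
    ∀ {V : Type v} [AddCommGroup V] [Module ℂ V] [FiniteDimensional ℂ V]
      {φ : G → LinearMap.GeneralLinearGroup ℂ V}, IsProjective φ → IsSimple φ → IsPrimitive φ →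
      (∀ g ∈ N (l - k), ∃ c : ℂˣ, φ g = c • 1) → HasFactorization π φ := by
  induction k with
  | zero =>
    intro V _ _ _ φ hφ hs hp hsc
    exact hasFactorization_of_forall_scalar π hφ hs fun g => hsc g (by simp [hl])
  | succ k ih =>
    intro V _ _ _ φ hφ hs hp hsc
    obtain ⟨h1, h2, h3⟩ := hN (l - (k + 1)) (by omega)
    have h4 := hle (l - (k + 1)) (by omega)
    rw [show l - (k + 1) + 1 = l - k by omega] at h2 h3 h4
    obtain ⟨Θ, _, _, _, _, W, e, T, S, he, hT, hS, hSs, hSp, hTK, hSK, hTN⟩ :=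
      exists_tensor_of_isPrimitive hφ hs hp (N (l - k))
    have hS := ih (by omega) hS hSs hSp hSK
    have hTN' : ∀ n ∈ N (l - (k + 1)), ∃ c : ℂˣ, T n = c • 1 :=
      fun n hn => hTN n (h4 hn) (hsc n hn)
    rcases h3 with h3 | h3
    · exact hS.tensor he hT h3 hTK hTN' hSK
    · have h5 := (hS.compl.tensor he hT h3 hTK hTN' hSK).compl
      rwa [compl_compl] at h5

theorem IsPiSeparable.hasFactorization [Finite G] [FiniteDimensional ℂ V]
    (hG : IsPiSeparable π G) (hφ : IsProjective φ) (hs : IsSimple φ) (hp : IsPrimitive φ) :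
    HasFactorization π φ := by
  obtain ⟨l, N, h0, hl, h⟩ := hG
  refine hasFactorization_of_isPrimitive hl (fun i hi => (h i hi).2) (fun i hi => (h i hi).1) le_rfl
    hφ hs hp fun g hg => ?_
  rw [Nat.sub_self, h0, Subgroup.mem_bot] at hg
  rw [hg]
  exact hφ.exists_one

end Factorization

/-! ### From maps up to scalars back to cocycles. -/

section Cocycles

variable {G : Type*} [Group G] {π : Set Nat.Primes} {V A B : Type*} [AddCommGroup V] [Module ℂ V]
  [AddCommGroup A] [Module ℂ A] [AddCommGroup B] [Module ℂ B]

lemma GL.smul_injective [Nontrivial V] (u : LinearMap.GeneralLinearGroup ℂ V) {b c : ℂˣ}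
    (h : b • u = c • u) : b = c := by
  have h1 := congrArg Units.val h
  rw [GL.coe_smul, GL.coe_smul] at h1
  exact Units.ext (smul_left_injective ℂ u.ne_zero h1)

lemma IsProjective.exists_twistedRep [Nontrivial V] {φ : G → LinearMap.GeneralLinearGroup ℂ V}
    (hφ : IsProjective φ) : ∃ (α : Z2 G) (ρ : TwistedRep α V), ρ.toFun = φ := by
  choose c hc using hφ
  refine ⟨⟨c, fun x y z => GL.smul_injective (φ (x * y * z)) ?_⟩, ⟨φ, hc⟩, rfl⟩
  rw [mul_smul, ← hc, ← smul_mul_assoc, ← hc, mul_assoc, hc y z, mul_smul_comm, hc, mul_smul,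
    mul_assoc x y z]

/-- A stable subspace is stable under all of End V, and rank-one operators move a nonzero vector
anywhere. -/
lemma TwistedRep.res_isIrreducible_of_span_eq_top [Nontrivial V] {α : Z2 G} (ρ : TwistedRep α V)
    (H : Subgroup G)
    (hH : Submodule.span ℂ (Set.range fun h : H => (ρ.toFun h : Module.End ℂ V)) = ⊤) :
    (ρ.res H).IsIrreducible := by
  refine ⟨‹_›, fun U hU => ?_⟩
  by_cases h0 : U = ⊥
  · exact Or.inl h0
  right
  obtain ⟨u, hu, hu0⟩ := (Submodule.ne_bot_iff U).1 h0
  obtain ⟨f, hf⟩ := Module.Projective.exists_dual_eq_one ℂ hu0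
  have key : ∀ X : Module.End ℂ V, ∀ w ∈ U, X w ∈ U := by
    intro X
    have hX : X ∈ Submodule.span ℂ (Set.range fun h : H => (ρ.toFun h : Module.End ℂ V)) :=
      hH ▸ Submodule.mem_top
    induction hX using Submodule.span_induction with
    | mem x hx =>
      obtain ⟨h, rfl⟩ := hx
      exact hU h
    | zero => exact fun w _ => U.zero_mem
    | add x y _ _ hx hy => exact fun w hw => U.add_mem (hx w hw) (hy w hw)
    | smul c x _ hx => exact fun w hw => U.smul_mem c (hx w hw)
  rw [eq_top_iff]
  rintro v -
  have h1 := key (LinearMap.smulRight f v) u hu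
  rwa [LinearMap.smulRight_apply, hf, one_smul] at h1

lemma TwistedRep.IsIrreducible.of_res {α : Z2 G} {ρ : TwistedRep α V} {H : Subgroup G}
    (h : (ρ.res H).IsIrreducible) : ρ.IsIrreducible :=
  ⟨h.1, fun U hU => h.2 U fun g w hw => hU g w hw⟩

lemma TwistedRep.cocycle_mul_eq [Nontrivial A] [Nontrivial B] {α β γ : Z2 G}
    (σ : TwistedRep γ V) (ρ : TwistedRep α A) (τ : TwistedRep β B) (e : V ≃ₗ[ℂ] A ⊗[ℂ] B)
    (he : ∀ g v, e (σ.act g v) = (ρ.tensor τ).act g (e v)) : α * β = γ := by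
  refine Subtype.ext (funext fun x => funext fun y => ?_)
  have : Nontrivial (A ⊗[ℂ] B) := inferInstance
  refine GL.smul_injective ((ρ.tensor τ).toFun (x * y)) (Units.ext (LinearMap.ext fun t => ?_))
  obtain ⟨v, rfl⟩ := e.surjective t
  have h1 := σ.act_act x y v
  apply_fun e at h1
  rw [he, he, TwistedRep.act_act, map_smul, he] at h1
  exact h1

/-- The coclass restricted to H is killed by the coprime numbers |H| and n, hence is trivial. -/
lemma TwistedRep.res_isOrdinary_of_pow_eq_one {α : Z2 G} (ρ : TwistedRep α V) {n : ℕ}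
    (hn : IsPiNumber πᶜ n) (hα : Z2.coclass α ^ n = 1) (H : Subgroup G) [Finite H]
    (hH : IsPiNumber π (Nat.card H)) : (ρ.res H).IsOrdinary := by
  refine (ρ.res H).isOrdinary_of_coclass_eq_one ?_
  have h1 : Z2.coclass (Z2.res H α) ^ n = 1 := by
    rw [Z2.coclass_res, ← map_pow, hα, map_one]
  have h2 := pow_gcd_eq_one.2 ⟨H2.pow_card_eq_one (Z2.coclass (Z2.res H α)), h1⟩
  rwa [(hH.coprime hn).gcd_eq_one, pow_one] at h2

end Cocycles

/-! ### The tensor factors as twisted representations. -/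

section Factorization

variable {G : Type*} [Group G] {π : Set Nat.Primes} {V : Type v} [AddCommGroup V] [Module ℂ V]

lemma span_range_smul_eq_top {ι A : Type*} [AddCommGroup A] [Module ℂ A]
    {a : ι → LinearMap.GeneralLinearGroup ℂ A} (c : ι → ℂˣ)
    (h : Submodule.span ℂ (Set.range fun i => (a i : Module.End ℂ A)) = ⊤) :
    Submodule.span ℂ (Set.range fun i => ((c i • a i : LinearMap.GeneralLinearGroup ℂ A) :
      Module.End ℂ A)) = ⊤ := by
  rw [eq_top_iff, ← h, Submodule.span_le]
  rintro _ ⟨i, rfl⟩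
  have h1 : a i = (c i)⁻¹ • c i • a i := by rw [smul_smul, inv_mul_cancel, one_smul]
  dsimp only
  rw [h1, GL.coe_smul]
  exact Submodule.smul_mem _ _ (Submodule.subset_span ⟨i, rfl⟩)

theorem HasFactorization.exists_twistedRep {α : Z2 G} {ρ : TwistedRep α V}
    (h : HasFactorization π ρ.toFun) :
    ∃ (απ απ' : Z2 G) (_ : απ * απ' = α)
      (Vπ : Type v) (_ : AddCommGroup Vπ) (_ : Module ℂ Vπ) (_ : FiniteDimensional ℂ Vπ)
      (Vπ' : Type v) (_ : AddCommGroup Vπ') (_ : Module ℂ Vπ') (_ : FiniteDimensional ℂ Vπ')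
      (ρπ : TwistedRep απ Vπ) (ρπ' : TwistedRep απ' Vπ') (e : V ≃ₗ[ℂ] Vπ ⊗[ℂ] Vπ'),
      (∀ g v, e (ρ.act g v) = (ρπ.tensor ρπ').act g (e v)) ∧
      IsPiNumber π (Module.finrank ℂ Vπ) ∧ IsPiNumber πᶜ (Module.finrank ℂ Vπ') ∧
      (∀ H : Subgroup G, IsHallSubgroup π H → (ρπ.res H).IsIrreducible) ∧
      (∀ H : Subgroup G, IsHallSubgroup πᶜ H → (ρπ'.res H).IsIrreducible) := by
  obtain ⟨A, _, _, _, B, _, _, _, a, b, e, he, ha, hb, hA, hB, hHa, hHb⟩ := h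
  have hAn : Nontrivial A := Module.nontrivial_of_finrank_pos (R := ℂ) (Nat.pos_of_ne_zero hA.1)
  have hBn : Nontrivial B := Module.nontrivial_of_finrank_pos (R := ℂ) (Nat.pos_of_ne_zero hB.1)
  choose c hc using he
  -- All scalars are absorbed into the first factor. The tensor decomposition becomes exact, so the
  -- two cocycles multiply to α itself and not merely to a cohomologous cocycle.
  obtain ⟨απ, ρπ, hρπ⟩ := (ha.smul c).exists_twistedRep
  obtain ⟨απ', ρπ', rfl⟩ := hb.exists_twistedRep
  have key : ∀ g v, e (ρ.act g v) = (ρπ.tensor ρπ').act g (e v) := by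
    intro g v
    have h1 : (ρπ.tensor ρπ').act g = TensorProduct.map (ρπ.toFun g).val (ρπ'.toFun g).val := rfl
    rw [h1, hρπ]
    dsimp only
    rw [GL.coe_smul, TensorProduct.map_smul_left]
    exact hc g v
  refine ⟨απ, απ', ρ.cocycle_mul_eq ρπ ρπ' e key, A, _, _, ‹_›, B, _, _, ‹_›, ρπ, ρπ', e, key,
    hA, hB, fun H hH => ρπ.res_isIrreducible_of_span_eq_top H ?_,
    fun H hH => ρπ'.res_isIrreducible_of_span_eq_top H (hHb H hH)⟩
  rw [hρπ]
  exact span_range_smul_eq_top (fun h : H => c h) (hHa H hH)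

end Factorization

end

/-! ### The induced factorization and the identification of its coclasses. -/

theorem mainTheorem3 {G : Type u} [Group G] [Finite G] (π : Set Nat.Primes)
    (hG : IsPiSeparable π G)
    {V : Type v} [AddCommGroup V] [Module ℂ V] [FiniteDimensional ℂ V]
    (c : H2 G) (α : Z2 G) (hα : Z2.coclass α = c)
    (ρ : TwistedRep α V) (hρ : ρ.IsIrreducible) :
    ∃ cπ cπ' : H2 G,
      c = cπ * cπ' ∧ IsPiNumber π (orderOf cπ) ∧ IsPiNumber πᶜ (orderOf cπ') ∧
      ∃ (J : Subgroup G) (απ απ' : Z2 J) (hαJ : απ * απ' = Z2.res J α)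
        (Vπ : Type v) (_ : AddCommGroup Vπ) (_ : Module ℂ Vπ) (_ : FiniteDimensional ℂ Vπ)
        (Vπ' : Type v) (_ : AddCommGroup Vπ') (_ : Module ℂ Vπ') (_ : FiniteDimensional ℂ Vπ')
        (ρπ : TwistedRep απ Vπ) (ρπ' : TwistedRep απ' Vπ'),
        Z2.coclass απ = H2.res J cπ ∧ Z2.coclass απ' = H2.res J cπ' ∧
        ρπ.IsIrreducible ∧ ρπ'.IsIrreducible ∧
        ρ.IsIsomorphic (((ρπ.tensor ρπ').cast hαJ).ind) ∧
        (∃ H : Subgroup J, IsHallSubgroup π H) ∧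
        (∃ H' : Subgroup J, IsHallSubgroup πᶜ H') ∧
        (∀ H : Subgroup J, IsHallSubgroup π H →
          (ρπ.res H).IsIrreducible ∧ (ρπ'.res H).IsOrdinary) ∧
        (∀ H' : Subgroup J, IsHallSubgroup πᶜ H' →
          (ρπ'.res H').IsIrreducible ∧ (ρπ.res H').IsOrdinary) := by
  obtain ⟨cπ, cπ', hc, hcπ, hcπ'⟩ :=
    exists_eq_mul_orderOf_isPiNumber π c Nat.card_pos.ne' (H2.pow_card_eq_one c)
  obtain ⟨J, U, hU, hU0, hdim, hs, hp⟩ := ρ.exists_primitive_subrep hρ.isSimple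
  have hJ := hG.subgroup J
  obtain ⟨απ, απ', hαJ, A, _, _, _, B, _, _, _, ρπ, ρπ', e, he, hA, hB, hHA, hHB⟩ :=
    (hJ.hasFactorization (ρ.subrep J U hU).isProjective hs hp).exists_twistedRep
  obtain ⟨H, hH⟩ := hJ.exists_isHallSubgroup
  obtain ⟨H', hH'⟩ := hJ.compl.exists_isHallSubgroup
  have hmul : Z2.coclass απ * Z2.coclass απ' = H2.res J cπ * H2.res J cπ' := by
    rw [← map_mul, ← hc, ← hα, ← Z2.coclass_res, ← hαJ]
    rfl
  have hres : ∀ d : H2 G, H2.res J d ^ orderOf d = 1 := fun d => by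
    rw [← map_pow, pow_orderOf_eq_one, map_one]
  -- Both pairs multiply to the restriction of c. One pair is killed by the degrees of the factors,
  -- the other by the orders of `cπ` and `cπ'`, so uniqueness of the π-part applies.
  obtain ⟨h1, h2⟩ := eq_and_eq_of_mul_eq_mul_of_isPiNumber (M := H2 J) hmul hA hB hcπ hcπ'
    ρπ.coclass_pow_finrank ρπ'.coclass_pow_finrank (hres cπ) (hres cπ')
  refine ⟨cπ, cπ', hc, hcπ, hcπ', J, απ, απ', hαJ, A, _, _, ‹_›, B, _, _, ‹_›, ρπ, ρπ', h1, h2,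
    (hHA H hH).of_res, (hHB H' hH').of_res, ?_, ⟨H, hH⟩, ⟨H', hH'⟩,
    fun L hL => ⟨hHA L hL, ρπ'.res_isOrdinary_of_pow_eq_one hB ρπ'.coclass_pow_finrank L hL.1⟩,
    fun L hL => ⟨hHB L hL, ρπ.res_isOrdinary_of_pow_eq_one (by rwa [compl_compl])
      ρπ.coclass_pow_finrank L hL.1⟩⟩
  -- The composite of A ⊗ B ≅ U with U ≤ V is J-linear; it is the map extended by Frobenius
  -- reciprocity.
  have hj : ∀ (h : J) (t : A ⊗[ℂ] B), (U.subtype ∘ₗ e.symm.toLinearMap)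
      (((ρπ.tensor ρπ').cast hαJ).act h t) =
        ρ.act h ((U.subtype ∘ₗ e.symm.toLinearMap) t) := by
    intro h t
    obtain ⟨u, rfl⟩ := e.surjective t
    have h3 : ((ρπ.tensor ρπ').cast hαJ).act h (e u) = e ((ρ.subrep J U hU).act h u) :=
      (he h u).symm
    rw [h3]
    simp [TwistedRep.subrep_act_coe]
  refine TwistedRep.isIsomorphic_ind hj hρ.isSimple (fun h0 => ?_) (by
    rw [hdim, e.finrank_eq])
  obtain ⟨u, hu, hu0⟩ := (Submodule.ne_bot_iff U).1 hU0
  have h3 := LinearMap.congr_fun h0 (e ⟨u, hu⟩)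
  simp at h3
  exact hu0 h3
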